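/- For an ordinal $\alpha$ let $2^\alpha=\{0,1\}^\alpha$ carry the product topology. Assume the Diamond Principle $\Diamond$: there are $f_\alpha\in(2^\alpha)^\omega$, $\omega\le\alpha<\omega_1$, such that for every $f\in(2^{\omega_1})^\omega$ the set $\{\alpha\in[\omega,\omega_1):\ f(n)\restriction\alpha=f_\alpha(n)\text{ for all }n\in\omega\}$ is stationary in $\omega_1$. Then there are closed perfect sets $K_\alpha\subseteq 2^\alpha$, $\omega\le\alpha\le\omega_1$, which together with the restrictions $\pi^\beta_\alpha\colon K_\beta\to K_\alpha$, $x\mapsto x\restriction\alpha$ ($\omega\le\alpha\le\beta\le\omega_1$), form an inverse system based on simple extensions, that is: $K_\omega=2^\omega$; for every limit ordinal $\gamma$ with $\omega<\gamma\le\omega_1$, $K_\gamma$ is the inverse limit of $\langle K_\alpha:\omega\le\alpha<\gamma\rangle$, i.e. $K_\gamma=\{x\in 2^\gamma:\ x\restriction\alpha\in K_\alpha\text{ for all }\omega\le\alpha<\gamma\}$; and for every $\omega\le\gamma<\omega_1$ there is a point $x_\gamma\in K_\gamma$ such that $|(\pi_\gamma^{\gamma+1})^{-1}(x_\gamma)|=2$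 and $|(\pi_\gamma^{\gamma+1})^{-1}(y)|=1$ for all $y\in K_\gamma\setminus\{x_\gamma\}$. Moreover, the Boolean algebra $\mathcal A=\mathrm{Clopen}(K_{\omega_1})$ of clopen subsets of $K_{\omega_1}$ has the following properties. 1. $\mathcal A$ is minimally generated: there are an ordinal $\delta$ and an increasing sequence $\langle\mathcal A_\alpha:\alpha\le\delta\rangle$ of subalgebras of $\mathcal A$ such that $\mathcal A_\delta=\mathcal A$, $\mathcal A_0$ is isomorphic to the free Boolean algebra on countably infinitely many generators, $\mathcal A_\gamma=\bigcup_{\alpha<\gamma}\mathcal A_\alpha$ for every limit $\gamma\le\delta$, and for every $\alpha<\delta$ there is no subalgebra $\mathcal C$ with $\mathcal A_\alpha\subsetneq\mathcal C\subsetneq\mathcal A_{\alpha+1}$. 2. $\mathcal A$ has the Nikodym property: if $\langle\mu_n\rangle_{n\in\omega}$ is a sequence of finitely additive signed bounded measures on $\mathcal A$ with $\sup_n|\mu_n(A)|<\infty$ for every $A\in\mathcal A$, then $\sup_n\|\mu_n\|<\infty$, where $\|\mu\|=\sup\{|\mu(A)|+|\mu(B)|:\ A,B\in\mathcal A,\ A\wedge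 B=0\}$. 3. The Stone space of $\mathcal A$ (the space of ultrafilters on $\mathcal A$) is an Efimov space: an infinite compact Hausdorff space that contains neither a non-trivial convergent sequence (an injective sequence converging to a point that is not one of its terms) nor a homeomorphic copy of $\beta\omega$. -/

import Mathlib

open Set Filter Topology

/-! ### Generalized Cantor cubes and the Diamond Principle -/

/-- The space `2^α` for an ordinal `α`, with the product topology. -/
abbrev Cube (α : Ordinal.{0}) : Type 1 := Set.Iio α → Bool

/-- The natural projection `2^β → 2^α`, `x ↦ x ↾ α`, for `α ≤ β`. -/
def Cube.pr {α β : Ordinal.{0}} (h : α ≤ β) (x : Cube β) : Cube α :=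
  fun i => x (Set.inclusion (Set.Iio_subset_Iio h) i)

open scoped Ordinal in
/-- The Diamond Principle `◊`: there are `f_α ∈ (2^α)^ω`, `ω ≤ α < ω₁`, such that every
`g ∈ (2^{ω₁})^ω` is guessed, `g(n) ↾ α = f_α(n)` for all `n`, at stationarily many `α ∈ [ω, ω₁)`.
(The values `f_α` with `α < ω` play no role.) -/
def DiamondPrinciple : Prop :=
  ∃ f : (α : Set.Iio (ω₁ : Ordinal.{0})) → ℕ → Cube α.1,
    ∀ g : ℕ → Cube ω₁,
      IsStationary {α : Set.Iio (ω₁ : Ordinal.{0}) |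
        ω ≤ α.1 ∧ ∀ n, Cube.pr (le_of_lt α.2) (g n) = f α n}

/-! ### Inverse systems of simple extensions in `2^{ω₁}` -/

open scoped Ordinal in
/-- `⟨K_α, π_α^β : ω ≤ α ≤ β ≤ ω₁⟩`, with `K_α ⊆ 2^α` closed and perfect and `π_α^β` the restriction
of the natural projection, is an inverse system based on simple extensions. (Values `K α` with
`α ∉ [ω, ω₁]` play no role.) -/
structure IsSimpleExtensionSystem (K : (α : Ordinal.{0}) → Set (Cube α)) : Prop where
  /-- the first space is the whole Cantor space `2^ω` -/
  base : K ω = Set.univ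
  /-- each space is closed and has no isolated points -/
  perfect : ∀ α, ω ≤ α → α ≤ ω₁ → Perfect (K α)
  /-- the projections are the bonding maps -/
  mapsTo : ∀ α β (h : α ≤ β), ω ≤ α → β ≤ ω₁ → Set.MapsTo (Cube.pr h) (K β) (K α)
  /-- continuity: at a limit `γ`, `K γ` is the inverse limit of the earlier spaces
  (threads being identified with elements of `2^γ`) -/
  limit : ∀ γ, ω < γ → γ ≤ ω₁ → Order.IsSuccLimit γ →
    K γ = {x | ∀ α (h : α < γ), ω ≤ α → Cube.pr h.le x ∈ K α}
  /-- each successor space splits exactly one point of its predecessor, into two points -/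
  simple : ∀ γ, ω ≤ γ → γ < ω₁ →
    ∃ x ∈ K γ,
      {z ∈ K (γ + 1) | Cube.pr (le_self_add : γ ≤ γ + 1) z = x}.ncard = 2 ∧
      ∀ y ∈ K γ, y ≠ x → {z ∈ K (γ + 1) | Cube.pr (le_self_add : γ ≤ γ + 1) z = y}.ncard = 1

/-! ### Minimally generated Boolean algebras -/

section BooleanAlgebras

universe u

variable {A : Type u} [BooleanAlgebra A]

/-- `C` is a minimal extension of its subalgebra `B`. -/
def IsMinimalExtension (B C : BooleanSubalgebra A) : Prop :=
  B ≤ C ∧ ¬ ∃ D : BooleanSubalgebra A, B < D ∧ D < C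

/-- `B` is isomorphic to the countable free Boolean algebra `Fr(ω)`, that is, `B` is generated
by an independent sequence. -/
def IsFreeCountable (B : BooleanSubalgebra A) : Prop :=
  ∃ g : ℕ → A,
    (∀ s t : Finset ℕ, Disjoint s t → (s.inf g) ⊓ (t.inf fun i => (g i)ᶜ) ≠ ⊥) ∧
    BooleanSubalgebra.closure (Set.range g) = B

variable (A) in
/-- `A` is minimally generated: it is the last term of a continuous increasing well-ordered chain
of subalgebras that starts with a copy of `Fr(ω)` and whose successor steps are minimal. -/
def IsMinimallyGenerated : Prop :=
  ∃ (δ : Ordinal.{u}) (𝒜 : Ordinal.{u} → BooleanSubalgebra A),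
    (∀ α β, α ≤ β → β ≤ δ → 𝒜 α ≤ 𝒜 β) ∧
    𝒜 δ = ⊤ ∧
    IsFreeCountable (𝒜 0) ∧
    (∀ γ, γ ≤ δ → Order.IsSuccLimit γ → (𝒜 γ : Set A) = ⋃ α ∈ Set.Iio γ, (𝒜 α : Set A)) ∧
    (∀ α, α < δ → IsMinimalExtension (𝒜 α) (𝒜 (α + 1)))

/-! ### Measures on Boolean algebras and the Nikodym property -/

/-- The set of sums `|μ(a)| + |μ(b)|` with `a ∧ b = 0`. -/
def variationSums (μ : A → ℝ) : Set ℝ :=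
  {r | ∃ a b : A, Disjoint a b ∧ r = |μ a| + |μ b|}

/-- The norm `‖μ‖ = sup {|μ(a)| + |μ(b)| : a ∧ b = 0}`. -/
noncomputable def variationNorm (μ : A → ℝ) : ℝ := sSup (variationSums μ)

/-- `μ` is a (finitely additive, signed, bounded) measure on `A`. -/
structure IsBoundedMeasure (μ : A → ℝ) : Prop where
  additive : ∀ a b : A, Disjoint a b → μ (a ⊔ b) = μ a + μ b
  bounded : BddAbove (variationSums μ)

variable (A) in
/-- The Nikodym property: every pointwise bounded sequence of measures on `A` is uniformly
bounded. -/
def HasNikodymProperty : Prop :=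
  ∀ μ : ℕ → A → ℝ, (∀ n, IsBoundedMeasure (μ n)) →
    (∀ a, BddAbove (Set.range fun n => |μ n a|)) →
    BddAbove (Set.range fun n => variationNorm (μ n))

/-! ### Stone spaces -/

variable (A) in
/-- The Stone space of `A`: the set of ultrafilters on `A`. -/
def StoneSpace : Type u :=
  {F : Order.PFilter A // ⊥ ∉ F ∧ ∀ a, a ∈ F ∨ aᶜ ∈ F}

/-- The Stone topology, generated by the sets of ultrafilters containing a given element. -/
instance : TopologicalSpace (StoneSpace A) :=
  TopologicalSpace.generateFrom (Set.range fun a : A => {F : StoneSpace A | a ∈ F.1})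

end BooleanAlgebras

/-! ### Efimov spaces -/

/-- An Efimov space: an infinite compact Hausdorff space without non-trivial convergent sequences
and without a copy of `βω`. -/
structure IsEfimovSpace (X : Type*) [TopologicalSpace X] : Prop where
  compact : CompactSpace X
  hausdorff : T2Space X
  infinite : Infinite X
  no_sequence : ¬ ∃ (x : ℕ → X) (l : X), Tendsto x atTop (𝓝 l) ∧ Function.Injective x ∧
    ∀ n, x n ≠ l
  no_betaOmega : ¬ ∃ e : StoneCech ℕ → X, IsEmbedding e

/-! ### Measures on Boolean algebras -/

section Measures

universe u

variable {A : Type u} [BooleanAlgebra A]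

namespace IsBoundedMeasure

variable {μ : A → ℝ}

lemma map_bot (h : IsBoundedMeasure μ) : μ ⊥ = 0 := by
  have := h.additive ⊥ ⊥ disjoint_bot_left
  simp at this
  exact this

lemma inf_add_sdiff (h : IsBoundedMeasure μ) (a b : A) : μ (a ⊓ b) + μ (a \ b) = μ a := by
  rw [← h.additive _ _ (disjoint_inf_sdiff), sup_inf_sdiff]

lemma add_sdiff_of_le (h : IsBoundedMeasure μ) {a b : A} (hab : b ≤ a) :
    μ b + μ (a \ b) = μ a := by
  have := h.inf_add_sdiff a b
  rwa [inf_eq_right.2 hab] at this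

lemma abs_le_variationNorm (h : IsBoundedMeasure μ) (a : A) : |μ a| ≤ variationNorm μ := by
  refine le_csSup h.bounded ⟨a, ⊥, disjoint_bot_right, ?_⟩
  simp [h.map_bot]

lemma neg (h : IsBoundedMeasure μ) : IsBoundedMeasure fun a => -μ a where
  additive a b hab := by simp [h.additive a b hab]; ring
  bounded := by
    have : variationSums (fun a => -μ a) = variationSums μ := by simp [variationSums]
    rw [this]; exact h.bounded

lemma of_abs_le (hadd : ∀ a b : A, Disjoint a b → μ (a ⊔ b) = μ a + μ b) {C : ℝ}
    (hC : ∀ a, |μ a| ≤ C) : IsBoundedMeasure μ := by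
  refine ⟨hadd, C + C, ?_⟩
  rintro _ ⟨a, b, -, rfl⟩
  exact add_le_add (hC a) (hC b)

end IsBoundedMeasure

lemma variationNorm_le {μ : A → ℝ} {C : ℝ} (hC : ∀ a, |μ a| ≤ C) : variationNorm μ ≤ C + C := by
  refine csSup_le ⟨_, ⊥, ⊥, disjoint_bot_left, rfl⟩ ?_
  rintro _ ⟨a, b, -, rfl⟩
  exact add_le_add (hC a) (hC b)

/-- A sequence of measures witnessing the failure of the Nikodym property. -/
structure IsAntiNikodym (μ : ℕ → A → ℝ) : Prop where
  measure : ∀ n, IsBoundedMeasure (μ n)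
  pointwise : ∀ a, ∃ C, ∀ n, |μ n a| ≤ C
  unbounded : ∀ M : ℝ, ∃ n a, M < |μ n a|

lemma hasNikodymProperty_iff : HasNikodymProperty A ↔ ¬ ∃ μ : ℕ → A → ℝ, IsAntiNikodym μ := by
  constructor
  · rintro h ⟨μ, hμ⟩
    obtain ⟨M, hM⟩ := h μ hμ.measure fun a => by
      obtain ⟨C, hC⟩ := hμ.pointwise a
      exact ⟨C, by rintro _ ⟨n, rfl⟩; exact hC n⟩
    obtain ⟨n, a, hna⟩ := hμ.unbounded M
    exact absurd (hM ⟨n, rfl⟩) (not_le.2 (hna.trans_le ((hμ.measure n).abs_le_variationNorm a)))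
  · intro h μ hμ hp
    by_contra hb
    refine h ⟨μ, hμ, fun a => ?_, fun M => ?_⟩
    · obtain ⟨C, hC⟩ := hp a
      exact ⟨C, fun n => hC ⟨n, rfl⟩⟩
    · by_contra! hM
      exact hb ⟨M + M, by rintro _ ⟨n, rfl⟩; exact variationNorm_le (hM n)⟩

end Measures

section Clopen

open TopologicalSpace

universe u

variable {X : Type u} [TopologicalSpace X]

/-- The Dirac measure at a point, as a function on clopen sets. -/
noncomputable def clopenDirac (x : X) (a : Clopens X) : ℝ :=
  (a : Set X).indicator 1 x

lemma clopenDirac_sup (x : X) {a b : Clopens X} (h : Disjoint a b) :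
    clopenDirac x (a ⊔ b) = clopenDirac x a + clopenDirac x b := by
  have := Set.indicator_union_of_disjoint (Clopens.coe_disjoint.2 h) (1 : X → ℝ)
  simpa [clopenDirac] using congrFun this x

lemma clopenDirac_of_mem {x : X} {a : Clopens X} (h : x ∈ a) : clopenDirac x a = 1 :=
  Set.indicator_of_mem (s := (a : Set X)) h 1

lemma clopenDirac_of_notMem {x : X} {a : Clopens X} (h : x ∉ a) : clopenDirac x a = 0 :=
  Set.indicator_of_notMem (s := (a : Set X)) h 1

lemma abs_clopenDirac_le (x : X) (a : Clopens X) : |clopenDirac x a| ≤ 1 := by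
  by_cases h : x ∈ a
  · simp [clopenDirac_of_mem h]
  · simp [clopenDirac_of_notMem h]

lemma exists_clopens_of_mem_nhds [CompactSpace X] [T2Space X] [TotallyDisconnectedSpace X]
    {x : X} {s : Set X} (hs : s ∈ 𝓝 x) : ∃ W : Clopens X, x ∈ W ∧ (W : Set X) ⊆ s := by
  obtain ⟨V, hV, hxV, hVs⟩ := compact_exists_isClopen_in_isOpen isOpen_interior
    (mem_interior_iff_mem_nhds.2 hs)
  exact ⟨⟨V, hV⟩, hxV, hVs.trans interior_subset⟩

/-- A non-trivial convergent sequence refutes the Nikodym property. -/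
lemma exists_isAntiNikodym_of_tendsto [CompactSpace X] [T2Space X] [TotallyDisconnectedSpace X]
    {x : ℕ → X} {l : X} (h : Tendsto x atTop (𝓝 l)) (hne : ∀ n, x n ≠ l) :
    ∃ μ : ℕ → Clopens X → ℝ, IsAntiNikodym μ := by
  refine ⟨fun n a => n * (clopenDirac (x n) a - clopenDirac l a), fun n => ?_, fun a => ?_,
    fun M => ?_⟩
  · refine .of_abs_le (C := n * 2) (fun a b hab => ?_) fun a => ?_
    · rw [clopenDirac_sup _ hab, clopenDirac_sup _ hab]; ring
    · rw [abs_mul, Nat.abs_cast]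
      gcongr
      calc _ ≤ |clopenDirac (x n) a| + |clopenDirac l a| := abs_sub _ _
        _ ≤ 1 + 1 := add_le_add (abs_clopenDirac_le _ _) (abs_clopenDirac_le _ _)
        _ = 2 := by norm_num
  · have key : ∀ᶠ n in atTop, clopenDirac (x n) a = clopenDirac l a := by
      by_cases hl : l ∈ a
      · filter_upwards [h.eventually (a.isOpen.mem_nhds hl)] with n hn
        rw [clopenDirac_of_mem hl, clopenDirac_of_mem hn]
      · filter_upwards [h.eventually (a.isClosed.isOpen_compl.mem_nhds hl)] with n hn
        rw [clopenDirac_of_notMem hl, clopenDirac_of_notMem hn]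
    obtain ⟨N, hN⟩ := eventually_atTop.1 key
    refine ⟨N * 2, fun n => ?_⟩
    rcases le_or_gt N n with hn | hn
    · rw [hN n hn]; simp
    · rw [abs_mul, Nat.abs_cast]
      have : |clopenDirac (x n) a - clopenDirac l a| ≤ 2 := by
        calc _ ≤ |clopenDirac (x n) a| + |clopenDirac l a| := abs_sub _ _
          _ ≤ 1 + 1 := add_le_add (abs_clopenDirac_le _ _) (abs_clopenDirac_le _ _)
          _ = 2 := by norm_num
      gcongr
  · obtain ⟨n, hn⟩ := exists_nat_gt M
    obtain ⟨W, hW, hWs⟩ := exists_clopens_of_mem_nhds (isOpen_compl_singleton.mem_nhds (hne n))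
    refine ⟨n, W, ?_⟩
    rw [clopenDirac_of_mem hW, clopenDirac_of_notMem fun h => hWs h rfl]
    simpa using hn

end Clopen

/-! ### Splitting a point so that pointwise boundedness fails -/

section Gliding

open TopologicalSpace

universe u

variable {X : Type u} [TopologicalSpace X]

/-- The sets which can be obtained from the closed set `P` by removing a small clopen
neighbourhood of `x` have arbitrarily large measure. -/
def IsUnboundedOff (μ : ℕ → Clopens X → ℝ) (x : X) (P : Set X) : Prop :=
  ∀ M : ℝ, ∃ n, ∃ W₀ : Clopens X, x ∈ W₀ ∧ ∀ W : Clopens X, W ≤ W₀ → x ∈ W →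
    ∀ D : Clopens X, (D : Set X) = P \ W → M < |μ n D|

namespace IsAntiNikodym

variable {μ : ℕ → Clopens X → ℝ}

/-- A point is a concentration point if the measures are unbounded on each of its clopen
neighbourhoods. -/
lemma exists_concentration_point [CompactSpace X] (hμ : IsAntiNikodym μ) :
    ∃ x : X, ∀ W : Clopens X, x ∈ W → ∀ M : ℝ, ∃ n, ∃ b ≤ W, M < |μ n b| := by
  by_contra! hcon
  choose W hxW M hM using hcon
  obtain ⟨t, ht⟩ := isCompact_univ.elim_nhds_subcover (fun x => (W x : Set X))
    fun x _ => (W x).isOpen.mem_nhds (hxW x)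
  have key : ∀ s : Finset X, ∃ C : ℝ, ∀ n, ∀ b ≤ s.sup W, |μ n b| ≤ C := by
    intro s
    classical
    induction s using Finset.induction_on with
    | empty =>
      refine ⟨0, fun n b hb => ?_⟩
      have : b = ⊥ := by simpa using hb
      simp [this, (hμ.measure n).map_bot]
    | insert x s hx ih =>
      obtain ⟨C, hC⟩ := ih
      refine ⟨M x + C, fun n b hb => ?_⟩
      rw [Finset.sup_insert] at hb
      rw [← (hμ.measure n).inf_add_sdiff b (W x)]
      refine (abs_add_le _ _).trans (add_le_add (hM x n _ inf_le_right) (hC n _ ?_))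
      rwa [sdiff_le_iff]
  obtain ⟨C, hC⟩ := key t
  obtain ⟨n, a, ha⟩ := hμ.unbounded C
  refine absurd (hC n a fun x _ => ?_) (not_le.2 ha)
  have := ht.2 (mem_univ x)
  rw [← SetLike.mem_coe, Clopens.coe_finset_sup]
  simpa using this

lemma exists_notMem_of_concentration (hμ : IsAntiNikodym μ) {x : X}
    (hx : ∀ W : Clopens X, x ∈ W → ∀ M : ℝ, ∃ n, ∃ b ≤ W, M < |μ n b|) {W : Clopens X}
    (hW : x ∈ W) (M : ℝ) : ∃ n, ∃ b ≤ W, x ∉ b ∧ M < |μ n b| := by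
  obtain ⟨C, hC⟩ := hμ.pointwise W
  obtain ⟨n, b, hb, hM⟩ := hx W hW (|M| + C)
  have hC0 : 0 ≤ C := (abs_nonneg _).trans (hC n)
  by_cases hxb : x ∈ b
  · refine ⟨n, W \ b, sdiff_le, fun h => h.2 hxb, ?_⟩
    have h1 := (hμ.measure n).add_sdiff_of_le hb
    have h2 : |μ n b| ≤ |μ n W| + |μ n (W \ b)| := by
      rw [show μ n b = μ n W - μ n (W \ b) by linarith]; exact abs_sub _ _
    linarith [hC n, le_abs_self M]
  · exact ⟨n, b, hb, hxb, by linarith [le_abs_self M]⟩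

end IsAntiNikodym

/-- A bounded measure is small on clopen sets close to `x` that do not contain `x`. -/
lemma IsBoundedMeasure.exists_lt_near {μ : Clopens X → ℝ} (h : IsBoundedMeasure μ) (x : X) {ε : ℝ}
    (hε : 0 < ε) : ∃ W : Clopens X, x ∈ W ∧ ∀ c ≤ W, x ∉ c → |μ c| < ε := by
  have one : ∀ μ : Clopens X → ℝ, IsBoundedMeasure μ →
      ∃ W : Clopens X, x ∈ W ∧ ∀ c ≤ W, x ∉ c → μ c < ε := by
    intro μ h
    set S : Set ℝ := {r | ∃ c : Clopens X, x ∉ c ∧ μ c = r} with hS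
    have hbdd : BddAbove S := ⟨variationNorm μ, by
      rintro _ ⟨c, -, rfl⟩; exact (le_abs_self _).trans (h.abs_le_variationNorm c)⟩
    have hne : S.Nonempty := ⟨_, ⊥, fun h => h, rfl⟩
    obtain ⟨_, ⟨c, hxc, rfl⟩, hc⟩ := exists_lt_of_lt_csSup hne (sub_lt_self (sSup S) hε)
    refine ⟨cᶜ, hxc, fun d hd hxd => ?_⟩
    have hdisj : Disjoint c d := (le_compl_iff_disjoint_left.1 hd)
    have : μ (c ⊔ d) ≤ sSup S := le_csSup hbdd ⟨c ⊔ d, fun h => h.elim hxc hxd, rfl⟩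
    rw [h.additive _ _ hdisj] at this
    linarith
  obtain ⟨W₁, hx₁, h₁⟩ := one μ h
  obtain ⟨W₂, hx₂, h₂⟩ := one _ h.neg
  refine ⟨W₁ ⊓ W₂, ⟨hx₁, hx₂⟩, fun c hc hxc => abs_lt.2 ⟨?_, ?_⟩⟩
  · linarith [h₂ c (hc.trans inf_le_right) hxc]
  · exact h₁ c (hc.trans inf_le_left) hxc

/-- A stage of the gliding hump construction: a clopen neighbourhood `W` of `x`, whose complement
is split into `u` and `v`. -/
structure SplitStage (x : X) where
  W : Clopens X
  u : Clopens X
  v : Clopens X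
  mem : x ∈ W
  disj_u : Disjoint W u
  disj_v : Disjoint W v
  disj_uv : Disjoint u v
  cover : W ⊔ (u ⊔ v) = ⊤

/-- Exchange the two sides. -/
def SplitStage.swap {x : X} (s : SplitStage x) : SplitStage x :=
  ⟨s.W, s.v, s.u, s.mem, s.disj_v, s.disj_u, s.disj_uv.symm, by rw [sup_comm s.v]; exact s.cover⟩

/-- The stage `t` refines the stage `s`. -/
structure SplitStage.Refines {x : X} (t s : SplitStage x) : Prop where
  W_le : t.W ≤ s.W
  le_u : s.u ≤ t.u
  le_v : s.v ≤ t.v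

lemma SplitStage.exists_refines {μ : ℕ → Clopens X → ℝ} (hμ : IsAntiNikodym μ) {x : X}
    (hx : ∀ W : Clopens X, x ∈ W → ∀ M : ℝ, ∃ n, ∃ b ≤ W, M < |μ n b|) (s : SplitStage x)
    (B : Clopens X) (hB : x ∈ B) (M : ℝ) :
    ∃ t : SplitStage x, t.Refines s ∧ t.W ≤ B ∧
      ∃ n, ∀ c ≤ t.W, x ∉ c → M < |μ n (t.u ⊔ c)| := by
  obtain ⟨C, hC⟩ := hμ.pointwise s.u
  obtain ⟨n, b, hb, hxb, hM⟩ := hμ.exists_notMem_of_concentration hx s.mem (M + C + 1)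
  obtain ⟨W, hxW, hW⟩ := (hμ.measure n).exists_lt_near x one_pos
  have hub : Disjoint s.u b := (s.disj_u.mono_left hb).symm
  have hvb : Disjoint s.v b := (s.disj_v.mono_left hb).symm
  have hWle : W ⊓ B ⊓ (s.W \ b) ≤ s.W := inf_le_right.trans sdiff_le
  have hWb : Disjoint (W ⊓ B ⊓ (s.W \ b)) b := disjoint_sdiff_self_left.mono_left inf_le_right
  refine ⟨⟨W ⊓ B ⊓ (s.W \ b), s.u ⊔ b, (W ⊓ B ⊓ (s.W \ b) ⊔ (s.u ⊔ b))ᶜ, ⟨⟨hxW, hB⟩, s.mem, hxb⟩,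
    ?_, ?_, ?_, ?_⟩, ⟨hWle, le_sup_left, ?_⟩, inf_le_left.trans inf_le_right, n, ?_⟩
  · exact (s.disj_u.mono_left hWle).sup_right hWb
  · exact disjoint_compl_right.mono_left le_sup_left
  · exact disjoint_compl_right.mono_left le_sup_right
  · rw [← sup_assoc, sup_compl_eq_top]
  · rw [le_compl_iff_disjoint_right]
    exact (s.disj_v.symm.mono_right hWle).sup_right (s.disj_uv.symm.sup_right hvb)
  · intro c hc hxc
    have hcW : c ≤ W := hc.trans (inf_le_left.trans inf_le_left)
    have hd : Disjoint (s.u ⊔ b) c :=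
      ((s.disj_u.mono_left hWle).sup_right hWb).symm.mono_right hc
    change M < |μ n (s.u ⊔ b ⊔ c)|
    rw [(hμ.measure n).additive _ _ hd, (hμ.measure n).additive _ _ hub]
    have h1 : |μ n b| ≤ |μ n s.u + μ n b + μ n c| + |μ n s.u| + |μ n c| := by
      have : μ n b = (μ n s.u + μ n b + μ n c) + (-μ n s.u) + (-μ n c) := by ring
      calc |μ n b| = |(μ n s.u + μ n b + μ n c) + (-μ n s.u) + (-μ n c)| := by rw [← this]
        _ ≤ _ := by
          refine (abs_add_three _ _ _).trans ?_
          simp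
    linarith [hW c hcW hxc, hC n]

lemma SplitStage.exists_refines_both {μ : ℕ → Clopens X → ℝ} (hμ : IsAntiNikodym μ) {x : X}
    (hx : ∀ W : Clopens X, x ∈ W → ∀ M : ℝ, ∃ n, ∃ b ≤ W, M < |μ n b|) (s : SplitStage x)
    (B : Clopens X) (hB : x ∈ B) (M : ℝ) :
    ∃ t : SplitStage x, t.Refines s ∧ t.W ≤ B ∧
      (∃ n, ∀ c ≤ t.W, x ∉ c → M < |μ n (t.u ⊔ c)|) ∧
      ∃ n, ∀ c ≤ t.W, x ∉ c → M < |μ n (t.v ⊔ c)| := by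
  obtain ⟨t, hts, htB, n, hn⟩ := s.exists_refines hμ hx B hB M
  obtain ⟨r, hrt, -, m, hm⟩ := t.swap.exists_refines hμ hx B hB M
  have hW : r.W ≤ t.W := hrt.W_le
  have hu : t.u ≤ r.v := hrt.le_v
  have hv : t.v ≤ r.u := hrt.le_u
  refine ⟨r.swap, ⟨hW.trans hts.W_le, hts.le_u.trans hu, hts.le_v.trans hv⟩, hW.trans htB,
    ⟨n, fun c hc hxc => ?_⟩, ⟨m, hm⟩⟩
  have hsplit : r.v ⊔ c = t.u ⊔ ((r.v \ t.u) ⊔ c) := by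
    rw [← sup_assoc, sup_sdiff_cancel_right hu]
  change M < |μ n (r.v ⊔ c)|
  rw [hsplit]
  refine hn _ (sup_le ?_ (hc.trans hW)) ?_
  · rw [sdiff_le_iff]
    have h1 : r.v ≤ t.W ⊔ (t.u ⊔ t.v) := t.cover ▸ le_top
    have h2 : Disjoint r.v t.v := r.disj_uv.symm.mono_right hv
    rw [← sup_assoc] at h1
    rw [sup_comm t.u]
    exact Disjoint.left_le_of_le_sup_right h1 h2
  · rintro (h | h)
    · exact (Set.disjoint_left.1 (Clopens.coe_disjoint.2 r.disj_v)) r.mem h.1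
    · exact hxc h

/-- If the Nikodym property fails for the clopen algebra of `X`, then some point of `X` can be
split so that the measures become unbounded on both of the two new clopen sets. -/
theorem IsAntiNikodym.exists_split [CompactSpace X] [T2Space X] [TotallyDisconnectedSpace X]
    [FirstCountableTopology X] {μ : ℕ → Clopens X → ℝ} (hμ : IsAntiNikodym μ) :
    ∃ (x : X) (P Q : Set X), IsClosed P ∧ IsClosed Q ∧ P ∪ Q = univ ∧ P ∩ Q = {x} ∧
      IsUnboundedOff μ x P ∧ IsUnboundedOff μ x Q := by
  obtain ⟨x, hx⟩ := hμ.exists_concentration_point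
  obtain ⟨b, hb⟩ := (𝓝 x).exists_antitone_basis
  choose B hxB hBb using fun k => exists_clopens_of_mem_nhds (hb.1.mem_of_mem (i := k) trivial)
  choose next hnext hnextB hnextu hnextv using fun (s : SplitStage x) (k : ℕ) =>
    s.exists_refines_both hμ hx (B k) (hxB k) k
  let s : ℕ → SplitStage x := fun k => Nat.rec
    ⟨⊤, ⊥, ⊥, trivial, disjoint_bot_right, disjoint_bot_right, disjoint_bot_right, by simp⟩
    (fun k s => next s k) k
  have hs : ∀ k, s (k + 1) = next (s k) k := fun _ => rfl
  have hWanti : Antitone fun k => (s k).W := antitone_nat_of_succ_le fun k => (hnext _ k).W_le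
  have humono : Monotone fun k => (s k).u := monotone_nat_of_le_succ fun k => (hnext _ k).le_u
  have hvmono : Monotone fun k => (s k).v := monotone_nat_of_le_succ fun k => (hnext _ k).le_v
  have hWx : ∀ y, (∀ k, y ∈ (s k).W) → y = x := by
    intro y hy
    by_contra hyx
    obtain ⟨k, -, hk⟩ := hb.1.mem_iff.1 (isOpen_compl_singleton.mem_nhds (Ne.symm hyx))
    exact hk (hBb k (hnextB (s k) k (hy (k + 1)))) rfl
  have hcov : ∀ k y, y ∈ (s k).W ∨ y ∈ (s k).u ∨ y ∈ (s k).v := by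
    intro k y
    have : y ∈ (s k).W ⊔ ((s k).u ⊔ (s k).v) := by rw [(s k).cover]; trivial
    exact this
  have hdis : ∀ {a b : Clopens X}, Disjoint a b → ∀ {y}, y ∈ a → y ∉ b := fun h y hy hy' =>
    Set.disjoint_left.1 (Clopens.coe_disjoint.2 h) hy hy'
  set U : Set X := ⋃ k, ((s k).u : Set X) with hU
  set V : Set X := ⋃ k, ((s k).v : Set X) with hV
  have hUo : IsOpen U := isOpen_iUnion fun k => (s k).u.isOpen
  have hVo : IsOpen V := isOpen_iUnion fun k => (s k).v.isOpen
  have hxU : x ∉ U := by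
    simp only [hU, mem_iUnion, not_exists]
    exact fun k => hdis (s k).disj_u (s k).mem
  have hxV : x ∉ V := by
    simp only [hV, mem_iUnion, not_exists]
    exact fun k => hdis (s k).disj_v (s k).mem
  have hUV : ∀ y ∈ U, y ∉ V := by
    simp only [hU, hV, mem_iUnion, not_exists]
    rintro y ⟨k, hk⟩ l hl
    exact hdis (s (max k l)).disj_uv (humono (le_max_left k l) hk) (hvmono (le_max_right k l) hl)
  have hall : ∀ y, y ≠ x → y ∈ U ∨ y ∈ V := by
    intro y hy
    have : ¬ ∀ k, y ∈ (s k).W := fun h => hy (hWx y h)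
    push Not at this
    obtain ⟨k, hk⟩ := this
    rcases (hcov k y).resolve_left hk with h | h
    · exact .inl (mem_iUnion.2 ⟨k, h⟩)
    · exact .inr (mem_iUnion.2 ⟨k, h⟩)
  refine ⟨x, Vᶜ, Uᶜ, hVo.isClosed_compl, hUo.isClosed_compl, ?_, ?_, ?_, ?_⟩
  · rw [← compl_inter, compl_univ_iff]
    exact eq_empty_of_forall_notMem fun y hy => hUV y hy.2 hy.1
  · ext y
    simp only [mem_inter_iff, mem_compl_iff, mem_singleton_iff]
    refine ⟨fun h => ?_, ?_⟩
    · by_contra hyx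
      exact (hall y hyx).elim h.2 h.1
    · rintro rfl; exact ⟨hxV, hxU⟩
  · intro M
    obtain ⟨k, hk⟩ := exists_nat_gt M
    obtain ⟨n, hn⟩ := hnextu (s k) k
    rw [← hs] at hn
    refine ⟨n, (s (k + 1)).W, (s (k + 1)).mem, fun W hW hxW D hD => hk.trans ?_⟩
    have huD : (s (k + 1)).u ≤ D := by
      intro y hy
      rw [← SetLike.mem_coe, hD]
      exact ⟨hUV y (mem_iUnion.2 ⟨k + 1, hy⟩), fun h => hdis (s (k + 1)).disj_u (hW h) hy⟩
    rw [← sup_sdiff_cancel_right huD]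
    refine hn _ (fun y hy => ?_) fun hy => ?_
    · have h1 : y ∈ Vᶜ \ (W : Set X) := hD ▸ hy.1
      rcases hcov (k + 1) y with h | h | h
      · exact h
      · exact absurd h hy.2
      · exact (h1.1 (mem_iUnion.2 ⟨k + 1, h⟩)).elim
    · have h1 : x ∈ Vᶜ \ (W : Set X) := hD ▸ hy.1
      exact h1.2 hxW
  · intro M
    obtain ⟨k, hk⟩ := exists_nat_gt M
    obtain ⟨n, hn⟩ := hnextv (s k) k
    rw [← hs] at hn
    refine ⟨n, (s (k + 1)).W, (s (k + 1)).mem, fun W hW hxW D hD => hk.trans ?_⟩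
    have huD : (s (k + 1)).v ≤ D := by
      intro y hy
      rw [← SetLike.mem_coe, hD]
      exact ⟨fun h => hUV y h (mem_iUnion.2 ⟨k + 1, hy⟩),
        fun h => hdis (s (k + 1)).disj_v (hW h) hy⟩
    rw [← sup_sdiff_cancel_right huD]
    refine hn _ (fun y hy => ?_) fun hy => ?_
    · have h1 : y ∈ Uᶜ \ (W : Set X) := hD ▸ hy.1
      rcases hcov (k + 1) y with h | h | h
      · exact h
      · exact (h1.1 (mem_iUnion.2 ⟨k + 1, h⟩)).elim
      · exact absurd h hy.2
    · have h1 : x ∈ Uᶜ \ (W : Set X) := hD ▸ hy.1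
      exact h1.2 hxW

/-- Both sides of a split with unbounded measures accumulate at the split point. -/
lemma IsUnboundedOff.mem_closure [CompactSpace X] [T2Space X] [TotallyDisconnectedSpace X]
    {μ : ℕ → Clopens X → ℝ} (hμ : IsAntiNikodym μ) {x : X} {P Q : Set X} (hP : IsClosed P)
    (hQ : IsClosed Q) (hPQ : P ∪ Q = univ) (hx : P ∩ Q = {x}) (h : IsUnboundedOff μ x P) :
    x ∈ closure (P \ {x}) := by
  by_contra hcl
  obtain ⟨W, hxW, hW⟩ := exists_clopens_of_mem_nhds
    (isClosed_closure.isOpen_compl.mem_nhds hcl)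
  have hxPQ : x ∈ P ∩ Q := hx ▸ rfl
  have hset : ∀ W' : Clopens X, W' ≤ W → x ∈ W' → P \ (W' : Set X) = P \ (W : Set X) := by
    intro W' hW' hxW'
    refine Subset.antisymm (fun y hy => ⟨hy.1, fun hyW => ?_⟩) (sdiff_subset_sdiff_right hW')
    refine hW hyW (subset_closure ⟨hy.1, ?_⟩)
    rintro rfl
    exact hy.2 hxW'
  have hopen : P \ (W : Set X) = Qᶜ \ (W : Set X) := by
    ext y
    simp only [Set.mem_sdiff, mem_compl_iff, and_congr_left_iff]
    intro hyW
    have hy : y ∈ P ∪ Q := hPQ ▸ mem_univ y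
    refine ⟨fun h hq => hyW ?_, fun h => hy.resolve_right h⟩
    have : y ∈ ({x} : Set X) := hx ▸ ⟨h, hq⟩
    rw [mem_singleton_iff.1 this]; exact hxW
  let D : Clopens X := ⟨P \ W, hP.sdiff W.isOpen,
    hopen ▸ hQ.isOpen_compl.sdiff W.isClosed⟩
  obtain ⟨C, hC⟩ := hμ.pointwise D
  obtain ⟨n, W₀, hxW₀, hn⟩ := h C
  have := hn (W₀ ⊓ W) inf_le_left ⟨hxW₀, hxW⟩ D (hset _ inf_le_right ⟨hxW₀, hxW⟩).symm
  exact absurd (hC n) (not_le.2 this)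

end Gliding

/-! ### Dominating a sequence of measures by a positive one -/

section Domination

universe u

variable {A : Type u} [BooleanAlgebra A]

/-- The positive variation of a measure. -/
noncomputable def posVariation (μ : A → ℝ) (a : A) : ℝ := sSup (μ '' Iic a)

namespace IsBoundedMeasure

variable {μ : A → ℝ}

lemma bddAbove_image (h : IsBoundedMeasure μ) (a : A) : BddAbove (μ '' Iic a) :=
  ⟨variationNorm μ, by rintro _ ⟨b, -, rfl⟩; exact (le_abs_self _).trans (h.abs_le_variationNorm b)⟩

lemma le_posVariation (h : IsBoundedMeasure μ) {a b : A} (hb : b ≤ a) : μ b ≤ posVariation μ a :=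
  le_csSup (h.bddAbove_image a) ⟨b, hb, rfl⟩

lemma posVariation_nonneg (h : IsBoundedMeasure μ) (a : A) : 0 ≤ posVariation μ a :=
  h.map_bot ▸ h.le_posVariation bot_le

lemma posVariation_le (h : IsBoundedMeasure μ) (a : A) : posVariation μ a ≤ variationNorm μ :=
  csSup_le ⟨_, a, le_rfl, rfl⟩
    (by rintro _ ⟨b, -, rfl⟩; exact (le_abs_self _).trans (h.abs_le_variationNorm b))

lemma posVariation_sup (h : IsBoundedMeasure μ) {a b : A} (hab : Disjoint a b) :
    posVariation μ (a ⊔ b) = posVariation μ a + posVariation μ b := by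
  apply le_antisymm
  · refine csSup_le ⟨_, ⊥, bot_le, rfl⟩ ?_
    rintro _ ⟨c, hc, rfl⟩
    rw [← h.inf_add_sdiff c a]
    exact add_le_add (h.le_posVariation inf_le_right)
      (h.le_posVariation (sdiff_le_iff.2 hc))
  · refine le_of_forall_pos_le_add fun ε hε => ?_
    obtain ⟨_, ⟨c, hc, rfl⟩, hc'⟩ := exists_lt_of_lt_csSup (s := μ '' Iic a) ⟨_, ⊥, bot_le, rfl⟩
      (sub_lt_self _ (half_pos hε))
    obtain ⟨_, ⟨d, hd, rfl⟩, hd'⟩ := exists_lt_of_lt_csSup (s := μ '' Iic b) ⟨_, ⊥, bot_le, rfl⟩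
      (sub_lt_self _ (half_pos hε))
    have h1 := h.le_posVariation (sup_le_sup hc hd)
    rw [h.additive _ _ (hab.mono hc hd)] at h1
    unfold posVariation at *
    linarith

lemma abs_le_posVariation_add (h : IsBoundedMeasure μ) (a : A) :
    |μ a| ≤ posVariation μ a + posVariation (fun b => -μ b) a := by
  have h1 := h.le_posVariation (le_refl a)
  have h2 := h.neg.le_posVariation (le_refl a)
  have h3 := h.posVariation_nonneg a
  have h4 := h.neg.posVariation_nonneg a
  rw [abs_le]; constructor <;> linarith

lemma mono (h : IsBoundedMeasure μ) (h0 : ∀ a, 0 ≤ μ a) {a b : A} (hab : a ≤ b) : μ a ≤ μ b := by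
  linarith [h.add_sdiff_of_le hab, h0 (b \ a)]

end IsBoundedMeasure

/-- A sequence of bounded measures is dominated by a single positive one. -/
lemma exists_dominating_measure {μ : ℕ → A → ℝ} (hμ : ∀ n, IsBoundedMeasure (μ n)) :
    ∃ l : A → ℝ, IsBoundedMeasure l ∧ (∀ a, 0 ≤ l a) ∧
      ∃ C : ℕ → ℝ, (∀ n, 0 ≤ C n) ∧ ∀ n a, |μ n a| ≤ C n * l a := by
  set N : ℕ → ℝ := fun n => variationNorm (μ n) + variationNorm fun b => -μ n b with hN
  have hN0 : ∀ n, 0 ≤ N n := fun n => add_nonneg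
    ((abs_nonneg _).trans ((hμ n).abs_le_variationNorm ⊥))
    ((abs_nonneg _).trans ((hμ n).neg.abs_le_variationNorm ⊥))
  set v : ℕ → A → ℝ := fun n a => posVariation (μ n) a + posVariation (fun b => -μ n b) a with hv
  have hv0 : ∀ n a, 0 ≤ v n a := fun n a =>
    add_nonneg ((hμ n).posVariation_nonneg a) ((hμ n).neg.posVariation_nonneg a)
  have hvN : ∀ n a, v n a ≤ N n := fun n a =>
    add_le_add ((hμ n).posVariation_le a) ((hμ n).neg.posVariation_le a)
  set t : A → ℕ → ℝ := fun a n => (1 / 2) ^ n * (v n a / (1 + N n)) with ht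
  have ht0 : ∀ a n, 0 ≤ t a n := fun a n =>
    mul_nonneg (by positivity) (div_nonneg (hv0 n a) (by linarith [hN0 n]))
  have htle : ∀ a n, t a n ≤ (1 / 2) ^ n := fun a n => by
    refine mul_le_of_le_one_right (by positivity) ((div_le_one (by linarith [hN0 n])).2 ?_)
    linarith [hvN n a]
  have hsum : ∀ a, Summable (t a) := fun a =>
    Summable.of_nonneg_of_le (ht0 a) (htle a) summable_geometric_two
  have hl0 : ∀ a, 0 ≤ ∑' n, t a n := fun a => tsum_nonneg (ht0 a)
  refine ⟨fun a => ∑' n, t a n, .of_abs_le (C := 2) (fun a b hab => ?_) (fun a => ?_), hl0,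
    fun n => 2 ^ n * (1 + N n), fun n => mul_nonneg (by positivity) (by linarith [hN0 n]),
    fun n a => ?_⟩
  · rw [← (hsum a).tsum_add (hsum b)]
    congr 1 with n
    simp only [ht, hv, (hμ n).posVariation_sup hab, (hμ n).neg.posVariation_sup hab]
    ring
  · rw [abs_of_nonneg (hl0 a), ← tsum_geometric_two]
    exact (hsum a).tsum_le_tsum (htle a) summable_geometric_two
  · have h1 : t a n ≤ ∑' n, t a n := (hsum a).le_tsum n fun m _ => ht0 a m
    have hpos : 0 < 1 + N n := by linarith [hN0 n]
    calc |μ n a| ≤ v n a := (hμ n).abs_le_posVariation_add a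
      _ = 2 ^ n * (1 + N n) * t a n := by
        simp only [ht]
        field_simp
        rw [mul_assoc, ← mul_pow]; norm_num
      _ ≤ _ := by gcongr

end Domination

section Reflection

open TopologicalSpace
open scoped Ordinal

universe u

variable {X : Type u} [TopologicalSpace X]

/-- Along an `ω₁`-chain of subalgebras of clopen sets, the atoms of a positive measure are
eventually no longer divided. -/
lemma exists_reflecting_ordinal (ℬ : Ordinal.{0} → BooleanSubalgebra (Clopens X))
    (hmono : Monotone ℬ) (hunion : ∀ a, ∃ γ < ω₁, a ∈ ℬ γ) {l : Clopens X → ℝ}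
    (hl : IsBoundedMeasure l) (h0 : ∀ a, 0 ≤ l a) :
    ∃ γ₀ < (ω₁ : Ordinal.{0}), ∀ γ, γ₀ ≤ γ → ∀ (z : X) (a : Clopens X),
      (∀ ε > 0, ∃ W ∈ ℬ γ, z ∈ W ∧ l (W ⊓ a) < ε) ∨
      (∀ ε > 0, ∃ W ∈ ℬ γ, z ∈ W ∧ l (W \ a) < ε) := by
  classical
  set E : Finset (Clopens X) → ℝ := fun P => ∑ p ∈ P, l p ^ 2 with hE
  let IsPart : Finset (Clopens X) → Prop := fun P =>
    (∀ p ∈ P, ∀ q ∈ P, p ≠ q → Disjoint p q) ∧ ∀ x, ∃ p ∈ P, x ∈ p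
  set I : ℝ := sInf (E '' {P | IsPart P}) with hI
  have hbdd : BddBelow (E '' {P | IsPart P}) :=
    ⟨0, by rintro _ ⟨P, -, rfl⟩; exact Finset.sum_nonneg fun _ _ => sq_nonneg _⟩
  have hne : (E '' {P | IsPart P}).Nonempty := by
    refine ⟨_, {⊤}, ⟨?_, fun x => ⟨⊤, by simp, trivial⟩⟩, rfl⟩
    intro p hp q hq hpq
    rw [Finset.mem_singleton] at hp hq
    exact absurd (hp.trans hq.symm) hpq
  have hex : ∀ k : ℕ, ∃ P, IsPart P ∧ E P < I + 1 / (k + 1) := fun k => by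
    obtain ⟨_, ⟨P, hP, rfl⟩, h⟩ := exists_lt_of_csInf_lt hne
      (lt_add_of_pos_right I (by positivity : (0 : ℝ) < 1 / (k + 1)))
    exact ⟨P, hP, h⟩
  choose P hP hPE using hex
  choose ρ hρ hρmem using hunion
  let γ₀ : Ordinal := ⨆ i : Σ k, P k, ρ i.2
  have hle : ∀ k, ∀ p ∈ P k, ρ p ≤ γ₀ := fun k p hp =>
    Ordinal.le_iSup (fun i : Σ k, P k => ρ i.2) ⟨k, ⟨p, hp⟩⟩
  refine ⟨γ₀, Ordinal.iSup_lt_omega_one fun i => hρ _, fun γ hγ z a => ?_⟩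
  by_contra! hcon
  obtain ⟨⟨ε₁, hε₁, h₁⟩, ε₂, hε₂, h₂⟩ := hcon
  obtain ⟨k, hk⟩ := exists_nat_one_div_lt (by positivity : 0 < 2 * ε₁ * ε₂)
  obtain ⟨p, hp, hzp⟩ := (hP k).2 z
  have hpB : p ∈ ℬ γ := hmono ((hle k p hp).trans hγ) (hρmem p)
  have hp1 := h₁ p hpB hzp
  have hp2 := h₂ p hpB hzp
  have hadd := hl.inf_add_sdiff p a
  have hnot : ∀ q ≤ p, 0 < l q → q ∉ (P k).erase p := by
    intro q hq hlq hmem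
    obtain ⟨hne, hmem⟩ := Finset.mem_erase.1 hmem
    have : q = ⊥ := (disjoint_self.1 (((hP k).1 q hmem p hp hne).mono_right hq))
    rw [this, hl.map_bot] at hlq
    exact lt_irrefl _ hlq
  have hn2 : p \ a ∉ (P k).erase p := hnot _ sdiff_le (hε₂.trans_le hp2)
  have hn1 : p ⊓ a ∉ insert (p \ a) ((P k).erase p) := by
    rw [Finset.mem_insert, not_or]
    refine ⟨fun h => ?_, hnot _ inf_le_left (hε₁.trans_le hp1)⟩
    have hd : Disjoint (p ⊓ a) (p \ a) := disjoint_inf_sdiff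
    rw [← h, disjoint_self] at hd
    rw [hd, hl.map_bot] at hp1
    linarith
  have hpart : IsPart (insert (p ⊓ a) (insert (p \ a) ((P k).erase p))) := by
    have hout : ∀ q ∈ (P k).erase p, ∀ r ≤ p, Disjoint r q := fun q hq r hr =>
      ((hP k).1 p hp q (Finset.mem_of_mem_erase hq) (Finset.ne_of_mem_erase hq).symm).mono_left hr
    refine ⟨fun q hq r hr hqr => ?_, fun x => ?_⟩
    · simp only [Finset.mem_insert] at hq hr
      rcases hq with rfl | rfl | hq <;> rcases hr with rfl | rfl | hr
      · exact absurd rfl hqr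
      · exact disjoint_inf_sdiff
      · exact hout _ hr _ inf_le_left
      · exact disjoint_inf_sdiff.symm
      · exact absurd rfl hqr
      · exact hout _ hr _ sdiff_le
      · exact (hout _ hq _ inf_le_left).symm
      · exact (hout _ hq _ sdiff_le).symm
      · exact (hP k).1 _ (Finset.mem_of_mem_erase hq) _ (Finset.mem_of_mem_erase hr) hqr
    · obtain ⟨q, hq, hxq⟩ := (hP k).2 x
      by_cases hqp : q = p
      · subst hqp
        by_cases hxa : x ∈ a
        · exact ⟨q ⊓ a, by simp, hxq, hxa⟩
        · exact ⟨q \ a, by simp, hxq, hxa⟩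
      · exact ⟨q, by simp [hq, hqp], hxq⟩
  have hEI : I ≤ E (insert (p ⊓ a) (insert (p \ a) ((P k).erase p))) :=
    csInf_le hbdd ⟨_, hpart, rfl⟩
  have hsum : E (P k) = l p ^ 2 + ∑ q ∈ (P k).erase p, l q ^ 2 :=
    (Finset.add_sum_erase _ _ hp).symm
  have hEk := hPE k
  simp only [hE] at hEI hsum hEk
  rw [Finset.sum_insert hn1, Finset.sum_insert hn2] at hEI
  rw [hsum, ← hadd] at hEk
  have : ε₁ * ε₂ ≤ l (p ⊓ a) * l (p \ a) :=
    mul_le_mul hp1 hp2 hε₂.le (h0 _)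
  nlinarith

end Reflection

/-! ### Cubes -/

section Cubes

open TopologicalSpace
open scoped Ordinal

lemma exists_finset_of_mem_nhds {ι : Type*} {z : ι → Bool} {U : Set (ι → Bool)} (hU : U ∈ 𝓝 z) :
    ∃ F : Finset ι, ∀ y : ι → Bool, (∀ i ∈ F, y i = z i) → y ∈ U := by
  obtain ⟨V, hVU, hV, hzV⟩ := mem_nhds_iff.1 hU
  obtain ⟨F, u, hu, hFu⟩ := isOpen_pi_iff.1 hV z hzV
  refine ⟨F, fun y hy => hVU (hFu fun i hi => ?_)⟩
  rw [hy i hi]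
  exact (hu i hi).2

lemma isOpen_setOf_agree {ι : Type*} (z : ι → Bool) (F : Finset ι) :
    IsOpen {y : ι → Bool | ∀ i ∈ F, y i = z i} := by
  have : {y : ι → Bool | ∀ i ∈ F, y i = z i} = (F : Set ι).pi fun i => {z i} := by
    ext y; simp [Set.pi]
  rw [this]
  exact isOpen_set_pi F.finite_toSet fun i _ => isOpen_discrete _

/-- A clopen subset of a compact subset of a cube depends on finitely many coordinates. -/
lemma exists_finset_of_clopens {ι : Type*} {S : Set (ι → Bool)} (hS : IsCompact S)
    (C : Clopens S) :
    ∃ F : Finset ι, ∀ x y : S, (∀ i ∈ F, x.1 i = y.1 i) → (x ∈ C ↔ y ∈ C) := by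
  classical
  have : CompactSpace S := isCompact_iff_compactSpace.1 hS
  have key : ∀ D : Clopens S, ∀ x ∈ D, ∃ F : Finset ι,
      ∀ y : S, (∀ i ∈ F, y.1 i = x.1 i) → y ∈ D := by
    intro D x hx
    obtain ⟨U, hU, hUD⟩ := mem_nhds_induced Subtype.val x (D : Set S) |>.1
      (D.isOpen.mem_nhds hx)
    obtain ⟨F, hF⟩ := exists_finset_of_mem_nhds hU
    exact ⟨F, fun y hy => hUD (hF _ hy)⟩
  have key' : ∀ x : S, ∃ F : Finset ι, ∀ y : S, (∀ i ∈ F, y.1 i = x.1 i) → (y ∈ C ↔ x ∈ C) := by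
    intro x
    by_cases hx : x ∈ C
    · obtain ⟨F, hF⟩ := key C x hx
      exact ⟨F, fun y hy => iff_of_true (hF y hy) hx⟩
    · obtain ⟨F, hF⟩ := key Cᶜ x hx
      exact ⟨F, fun y hy => iff_of_false (hF y hy) hx⟩
  choose F hF using key'
  obtain ⟨t, ht⟩ := isCompact_univ.elim_nhds_subcover
    (fun x : S => {y : S | ∀ i ∈ F x, y.1 i = x.1 i}) fun x _ =>
      ((isOpen_setOf_agree x.1 (F x)).preimage continuous_subtype_val).mem_nhds fun _ _ => rfl
  refine ⟨t.biUnion F, fun x y hxy => ?_⟩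
  obtain ⟨w, hw, hxw⟩ := mem_iUnion₂.1 (ht.2 (mem_univ x))
  rw [hF w x hxw, hF w y fun i hi => ?_]
  rw [← hxy i (Finset.mem_biUnion.2 ⟨w, hw, hi⟩)]
  exact hxw i hi

namespace Cube

variable {α β γ : Ordinal.{0}}

lemma continuous_pr (h : α ≤ β) : Continuous (pr h) :=
  continuous_pi fun _ => continuous_apply _

/-- Extend a point of a cube by zeros. -/
noncomputable def extend (β : Ordinal.{0}) (x : Cube α) : Cube β :=
  open Classical in fun i => if h : i.1 < α then x ⟨i.1, h⟩ else false

lemma pr_extend (h : α ≤ β) (x : Cube α) : pr h (extend β x) = x := by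
  funext i
  have hi : i.1 < α := i.2
  simp [pr, extend, hi]

/-- The last coordinate of a point of `2^(γ+1)`. -/
def last (z : Cube (γ + 1)) : Bool := z ⟨γ, lt_add_one γ⟩

/-- Append a coordinate. -/
noncomputable def snoc (x : Cube γ) (b : Bool) : Cube (γ + 1) :=
  open Classical in fun i => if h : i.1 < γ then x ⟨i.1, h⟩ else b

@[simp] lemma pr_snoc (x : Cube γ) (b : Bool) : pr le_self_add (snoc x b) = x := by
  funext i
  have hi : i.1 < γ := i.2
  simp [pr, snoc, hi]

@[simp] lemma last_snoc (x : Cube γ) (b : Bool) : last (snoc x b) = b := by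
  simp [last, snoc]

lemma snoc_pr_last (z : Cube (γ + 1)) : snoc (pr le_self_add z) (last z) = z := by
  funext i
  by_cases hi : i.1 < γ
  · simp [snoc, hi, pr]
  · have : i = ⟨γ, lt_add_one γ⟩ :=
      Subtype.ext (le_antisymm (Order.lt_add_one_iff.1 i.2) (not_lt.1 hi))
    subst this
    simp [snoc, last]

lemma continuous_snoc (b : Bool) : Continuous fun x : Cube γ => snoc x b := by
  refine continuous_pi fun i => ?_
  by_cases hi : i.1 < γ
  · simp only [snoc, hi, dif_pos]; exact continuous_apply _
  · simp only [snoc, hi, dif_neg, not_false_iff]; exact continuous_const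

lemma continuous_last : Continuous (last : Cube (γ + 1) → Bool) := continuous_apply _

end Cube

lemma countable_Iio_of_lt_omega_one {γ : Ordinal.{0}} (h : γ < ω₁) : Countable (Iio γ) := by
  rw [← Cardinal.mk_le_aleph0_iff, Cardinal.mk_Iio_ordinal, ← Cardinal.lift_aleph0.{1, 0},
    Cardinal.lift_le, ← Order.lt_succ_iff, Cardinal.succ_aleph0, ← Cardinal.lt_ord]
  simpa using h

lemma countable_clopens_cube {γ : Ordinal.{0}} (h : γ < ω₁) : Countable (Clopens (Cube γ)) := by
  have := countable_Iio_of_lt_omega_one h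
  exact Clopens.countable_iff_secondCountable.2 inferInstance

/-- The preimage of a clopen set under a continuous map. -/
def clopensComap {X Y : Type*} [TopologicalSpace X] [TopologicalSpace Y] (f : X → Y)
    (hf : Continuous f) (E : Clopens Y) : Clopens X :=
  ⟨f ⁻¹' E, E.isClopen.preimage hf⟩

/-- The trace on `S ⊆ 2^γ` of a clopen subset of `2^α`, where `α ≤ γ`. -/
def clopenTrace {α γ : Ordinal.{0}} (S : Set (Cube γ)) (h : α ≤ γ) (E : Clopens (Cube α)) :
    Clopens S :=
  clopensComap (fun x : S => Cube.pr h x.1) ((Cube.continuous_pr h).comp continuous_subtype_val) E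

lemma exists_eq_clopenTrace {γ : Ordinal.{0}} (hγ : 0 < γ) {S : Set (Cube γ)} (hS : IsCompact S)
    (C : Clopens S) : ∃ α, ∃ h : α < γ, ∃ E : Clopens (Cube (α + 1)),
      C = clopenTrace S (Order.add_one_le_of_lt h) E := by
  obtain ⟨F, hF⟩ := exists_finset_of_clopens hS C
  let α : Ordinal := F.sup fun i => i.1
  have hα : α < γ := (Finset.sup_lt_iff (by simpa using hγ)).2 fun i _ => i.2
  have hFα : ∀ i ∈ F, i.1 < α + 1 := fun i hi =>
    Order.lt_add_one_iff.2 (Finset.le_sup (f := fun i : Iio γ => i.1) hi)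
  let r : Cube (α + 1) → (F → Bool) := fun y i => y ⟨i.1.1, hFα i.1 i.2⟩
  have hr : Continuous r := continuous_pi fun i => continuous_apply _
  let T : Set (F → Bool) := {t | ∃ x ∈ C, ∀ i : F, x.1 i.1 = t i}
  refine ⟨α, hα, ⟨r ⁻¹' T, (isClopen_discrete T).preimage hr⟩, ?_⟩
  ext x
  constructor
  · intro hx
    exact ⟨x, hx, fun i => rfl⟩
  · rintro ⟨y, hy, hyx⟩
    exact (hF y x fun i hi => hyx ⟨i, hi⟩).1 hy

end Cubes

/-! ### Guessing sequences of measures -/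

section Guessing

open TopologicalSpace
open scoped Ordinal

/-- An enumeration of the clopen subsets of `2^α`, for countable `α`. -/
noncomputable def clopenEnum (α : Ordinal.{0}) : ℕ → Clopens (Cube α) :=
  open Classical in if _h : Countable (Clopens (Cube α)) then
    (exists_surjective_nat (Clopens (Cube α))).choose else fun _ => ⊥

lemma clopenEnum_surjective {α : Ordinal.{0}} (h : α < ω₁) :
    Function.Surjective (clopenEnum α) := by
  have := countable_clopens_cube h
  rw [clopenEnum, dif_pos this]
  exact (exists_surjective_nat (Clopens (Cube α))).choose_spec

/-- An enumeration of the possible questions `q < μ_n(E_k)`. -/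
noncomputable def questionEnum : ℕ → ℕ × ℕ × ℚ := (exists_surjective_nat (ℕ × ℕ × ℚ)).choose

lemma questionEnum_surjective : Function.Surjective questionEnum :=
  (exists_surjective_nat (ℕ × ℕ × ℚ)).choose_spec

/-- The sequence `f` of points of `2^γ` codes the sequence `μ` of functions on the clopen subsets
of `S`: its values at `α` describe `μ` on the traces of clopen subsets of `2^(α+1)`. -/
def Codes {γ : Ordinal.{0}} (f : ℕ → Cube γ) {S : Set (Cube γ)} (μ : ℕ → Clopens S → ℝ) : Prop :=
  ∀ α (h : α < γ) (j : ℕ), f j ⟨α, h⟩ = true ↔ ((questionEnum j).2.2 : ℝ) <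
    μ (questionEnum j).1 (clopenTrace S (Order.add_one_le_of_lt h)
      (clopenEnum (α + 1) (questionEnum j).2.1))

lemma Codes.unique {γ : Ordinal.{0}} (h0 : 0 < γ) (hγ : γ < ω₁) {f : ℕ → Cube γ}
    {S : Set (Cube γ)} (hS : IsCompact S) {μ ν : ℕ → Clopens S → ℝ} (hμ : Codes f μ)
    (hν : Codes f ν) : μ = ν := by
  funext n C
  obtain ⟨α, hα, E, rfl⟩ := exists_eq_clopenTrace h0 hS C
  obtain ⟨k, rfl⟩ := clopenEnum_surjective ((Order.add_one_le_of_lt hα).trans_lt hγ) E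
  refine eq_of_forall_rat_lt_iff_lt fun q => ?_
  obtain ⟨j, hj⟩ := questionEnum_surjective (n, k, q)
  have h1 := hμ α hα j
  have h2 := hν α hα j
  rw [hj] at h1 h2
  exact h1.symm.trans h2

/-- The two closed sets `P`, `Q` cover `S`, meet in one point at which both accumulate, and destroy
the sequence of measures coded by `f`, if it witnesses the failure of the Nikodym property. -/
structure IsGoodSplit {γ : Ordinal.{0}} (f : ℕ → Cube γ) (S P Q : Set (Cube γ)) (x : S) : Prop where
  closed_left : IsClosed P
  closed_right : IsClosed Q
  union : P ∪ Q = S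
  inter : P ∩ Q = {x.1}
  acc_left : x.1 ∈ closure (P \ {x.1})
  acc_right : x.1 ∈ closure (Q \ {x.1})
  destroys : ∀ μ : ℕ → Clopens S → ℝ, IsAntiNikodym μ → Codes f μ →
    IsUnboundedOff μ x (Subtype.val ⁻¹' P) ∧ IsUnboundedOff μ x (Subtype.val ⁻¹' Q)

lemma exists_isAntiNikodym_of_perfect {γ : Ordinal.{0}} (hγ : γ < ω₁) {S : Set (Cube γ)}
    (hS : Perfect S) (hne : S.Nonempty) : ∃ μ : ℕ → Clopens S → ℝ, IsAntiNikodym μ := by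
  have := countable_Iio_of_lt_omega_one hγ
  have : CompactSpace S := isCompact_iff_compactSpace.1 hS.closed.isCompact
  obtain ⟨x, hx⟩ := hne
  have hcl : x ∈ closure (S \ {x}) := mem_closure_iff_nhds.2 fun U hU => by
    obtain ⟨y, hy, hyx⟩ := preperfect_iff_nhds.1 hS.acc x hx U hU
    exact ⟨y, hy.1, hy.2, hyx⟩
  obtain ⟨y, hy, hyx⟩ := mem_closure_iff_seq_limit.1 hcl
  exact exists_isAntiNikodym_of_tendsto (x := fun n => (⟨y n, (hy n).1⟩ : S)) (l := ⟨x, hx⟩)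
    (tendsto_subtype_rng.2 hyx) fun n h => (hy n).2 (congrArg Subtype.val h)

lemma exists_isGoodSplit {γ : Ordinal.{0}} (h0 : 0 < γ) (hγ : γ < ω₁) (f : ℕ → Cube γ)
    {S : Set (Cube γ)} (hS : Perfect S) (hne : S.Nonempty) :
    ∃ P Q x, IsGoodSplit f S P Q x := by
  have := countable_Iio_of_lt_omega_one hγ
  have : CompactSpace S := isCompact_iff_compactSpace.1 hS.closed.isCompact
  obtain ⟨μ, hμ, hcode⟩ : ∃ μ : ℕ → Clopens S → ℝ, IsAntiNikodym μ ∧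
      ∀ ν : ℕ → Clopens S → ℝ, IsAntiNikodym ν → Codes f ν → ν = μ := by
    by_cases h : ∃ μ : ℕ → Clopens S → ℝ, IsAntiNikodym μ ∧ Codes f μ
    · obtain ⟨μ, hμ, hc⟩ := h
      exact ⟨μ, hμ, fun ν _ hν => hν.unique h0 hγ hS.closed.isCompact hc⟩
    · obtain ⟨μ, hμ⟩ := exists_isAntiNikodym_of_perfect hγ hS hne
      exact ⟨μ, hμ, fun ν h1 h2 => absurd ⟨ν, h1, h2⟩ h⟩
  obtain ⟨x, P, Q, hP, hQ, hPQ, hx, hPu, hQu⟩ := hμ.exists_split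
  have hemb := hS.closed.isClosedEmbedding_subtypeVal
  have hacc : ∀ R : Set S, x ∈ closure (R \ {x}) →
      x.1 ∈ closure (Subtype.val '' R \ {x.1}) := by
    intro R hR
    have := image_closure_subset_closure_image continuous_subtype_val (mem_image_of_mem _ hR)
    refine closure_mono ?_ this
    rintro _ ⟨y, hy, rfl⟩
    exact ⟨⟨y, hy.1, rfl⟩, fun h => hy.2 (Subtype.ext h)⟩
  refine ⟨Subtype.val '' P, Subtype.val '' Q, x, hemb.isClosedMap _ hP, hemb.isClosedMap _ hQ,
    ?_, ?_, hacc P ?_, hacc Q ?_, fun ν hν hc => ?_⟩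
  · rw [← image_union, hPQ, image_univ, Subtype.range_coe]
  · rw [← image_inter Subtype.val_injective, hx, image_singleton]
  · exact hPu.mem_closure hμ hP hQ hPQ hx
  · exact hQu.mem_closure hμ hQ hP (by rw [union_comm, hPQ]) (by rw [inter_comm, hx])
  · rw [hcode ν hν hc, preimage_image_eq _ Subtype.val_injective,
      preimage_image_eq _ Subtype.val_injective]
    exact ⟨hPu, hQu⟩

lemma IsGoodSplit.symm {γ : Ordinal.{0}} {f : ℕ → Cube γ} {S P Q : Set (Cube γ)} {x : S}
    (h : IsGoodSplit f S P Q x) : IsGoodSplit f S Q P x where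
  closed_left := h.closed_right
  closed_right := h.closed_left
  union := by rw [union_comm, h.union]
  inter := by rw [inter_comm, h.inter]
  acc_left := h.acc_right
  acc_right := h.acc_left
  destroys μ h1 h2 := (h.destroys μ h1 h2).symm

lemma IsGoodSplit.preperfect_left {γ : Ordinal.{0}} {f : ℕ → Cube γ} {S P Q : Set (Cube γ)}
    {x : S} (h : IsGoodSplit f S P Q x) (hS : Preperfect S) : Preperfect P := by
  rw [preperfect_iff_nhds] at hS ⊢
  intro y hy U hU
  by_cases hyx : y = x.1
  · subst hyx
    obtain ⟨w, hwU, hwP, hwx⟩ := mem_closure_iff_nhds.1 h.acc_left U hU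
    exact ⟨w, ⟨hwU, hwP⟩, hwx⟩
  · have hyQ : y ∉ Q := fun hq => hyx (by simpa using h.inter.subset ⟨hy, hq⟩)
    obtain ⟨w, ⟨⟨hwU, hwQ⟩, hwS⟩, hwy⟩ := hS y (h.union.subset (.inl hy)) (U ∩ Qᶜ)
      (inter_mem hU (h.closed_right.isOpen_compl.mem_nhds hyQ))
    exact ⟨w, ⟨hwU, (h.union.superset hwS).resolve_right hwQ⟩, hwy⟩

end Guessing

/-! ### The inverse system -/

section Tower

open TopologicalSpace
open scoped Ordinal

/-- The subset of `2^(γ+1)` obtained by placing `P` and `Q` on the two levels. -/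
def succSet {γ : Ordinal.{0}} (P Q : Set (Cube γ)) : Set (Cube (γ + 1)) :=
  {z | (z.last = true ∧ Cube.pr le_self_add z ∈ P) ∨ (z.last = false ∧ Cube.pr le_self_add z ∈ Q)}

lemma IsGoodSplit.perfect_succSet {γ : Ordinal.{0}} {f : ℕ → Cube γ} {S P Q : Set (Cube γ)}
    {x : S} (h : IsGoodSplit f S P Q x) (hS : Preperfect S) : Perfect (succSet P Q) := by
  have hpr := Cube.continuous_pr (le_self_add : γ ≤ γ + 1)
  refine ⟨?_, ?_⟩
  · exact (((isClosed_discrete {true}).preimage Cube.continuous_last).inter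
      (h.closed_left.preimage hpr)).union
      (((isClosed_discrete {false}).preimage Cube.continuous_last).inter
      (h.closed_right.preimage hpr))
  · have key : ∀ (R : Set (Cube γ)) (b : Bool), Preperfect R →
        (∀ y ∈ R, Cube.snoc y b ∈ succSet P Q) → ∀ z : Cube (γ + 1), z.last = b →
        Cube.pr le_self_add z ∈ R → ∀ U ∈ 𝓝 z, ∃ w ∈ U ∩ succSet P Q, w ≠ z := by
      rintro R b hR hsub z rfl hzR U hU
      have hU' : (fun y => Cube.snoc y z.last) ⁻¹' U ∈ 𝓝 (Cube.pr (le_self_add : γ ≤ γ + 1) z) :=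
        (Cube.continuous_snoc z.last).continuousAt.preimage_mem_nhds
          (by rwa [Cube.snoc_pr_last])
      obtain ⟨y, ⟨hyU, hyR⟩, hne⟩ := preperfect_iff_nhds.1 hR _ hzR _ hU'
      refine ⟨_, ⟨hyU, hsub y hyR⟩, fun heq => hne ?_⟩
      rw [← heq, Cube.pr_snoc]
    rw [preperfect_iff_nhds]
    rintro z (⟨hz, hzP⟩ | ⟨hz, hzQ⟩)
    · exact key P true (h.preperfect_left hS) (fun y hy => .inl (by simpa using hy)) z hz hzP
    · exact key Q false (h.symm.preperfect_left hS) (fun y hy => .inr (by simpa using hy)) z hz hzQ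

/-- Choice of a split, where possible. -/
noncomputable def splitPair (f : (α : Iio (ω₁ : Ordinal.{0})) → ℕ → Cube α.1) (γ : Ordinal.{0})
    (S : Set (Cube γ)) : Set (Cube γ) × Set (Cube γ) :=
  open Classical in
  if h : ∃ R : Set (Cube γ) × Set (Cube γ), ∃ (hγ : γ < ω₁) (x : S),
    IsGoodSplit (f ⟨γ, hγ⟩) S R.1 R.2 x then h.choose else (S, S)

/-- The inverse system determined by the guesses `f`. -/
noncomputable def tower (f : (α : Iio (ω₁ : Ordinal.{0})) → ℕ → Cube α.1) (α : Ordinal.{0}) :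
    Set (Cube α) :=
  Ordinal.limitRecOn (motive := fun α => Set (Cube α)) α univ
    (fun γ S => succSet (splitPair f γ S).1 (splitPair f γ S).2)
    (fun γ _ K => {x | ∀ α (h : α < γ), ω ≤ α → Cube.pr h.le x ∈ K α h})

variable (f : (α : Iio (ω₁ : Ordinal.{0})) → ℕ → Cube α.1)

lemma tower_add_one (γ : Ordinal.{0}) :
    tower f (γ + 1) = succSet (splitPair f γ (tower f γ)).1 (splitPair f γ (tower f γ)).2 :=
  Ordinal.limitRecOn_add_one ..

lemma tower_limit {γ : Ordinal.{0}} (hγ : Order.IsSuccLimit γ) :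
    tower f γ = {x | ∀ α (h : α < γ), ω ≤ α → Cube.pr h.le x ∈ tower f α} :=
  Ordinal.limitRecOn_limit _ _ _ _ hγ

lemma tower_omega0 : tower f ω = univ := by
  rw [tower_limit f Ordinal.isSuccLimit_omega0]
  exact eq_univ_of_forall fun x α h h' => absurd h' (not_le.2 h)

/-- The inductive hypothesis of the construction. -/
structure TowerAt (γ : Ordinal.{0}) : Prop where
  perfect : Perfect (tower f γ)
  mapsTo : ∀ α (h : α ≤ γ), ω ≤ α → MapsTo (Cube.pr h) (tower f γ) (tower f α)
  surjOn : ∀ α (h : α ≤ γ), ω ≤ α → SurjOn (Cube.pr h) (tower f γ) (tower f α)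

variable {f}

lemma TowerAt.nonempty {γ : Ordinal.{0}} (h : TowerAt f γ) (hγ : ω ≤ γ) : (tower f γ).Nonempty := by
  obtain ⟨z, hz, -⟩ := h.surjOn ω hγ le_rfl (tower_omega0 f ▸ mem_univ fun _ => false)
  exact ⟨z, hz⟩

lemma TowerAt.exists_split {γ : Ordinal.{0}} (h : TowerAt f γ) (hγ : ω ≤ γ) (hγ₁ : γ < ω₁) :
    ∃ P Q x, IsGoodSplit (f ⟨γ, hγ₁⟩) (tower f γ) P Q x ∧ tower f (γ + 1) = succSet P Q := by
  have hex : ∃ R : Set (Cube γ) × Set (Cube γ), ∃ (hγ : γ < ω₁) (x : tower f γ),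
      IsGoodSplit (f ⟨γ, hγ⟩) (tower f γ) R.1 R.2 x := by
    obtain ⟨P, Q, x, hx⟩ := exists_isGoodSplit (Ordinal.omega0_pos.trans_le hγ) hγ₁ (f ⟨γ, hγ₁⟩)
      h.perfect (h.nonempty hγ)
    exact ⟨(P, Q), hγ₁, x, hx⟩
  obtain ⟨_, x, hx⟩ := hex.choose_spec
  refine ⟨_, _, x, hx, ?_⟩
  rw [tower_add_one, splitPair, dif_pos hex]

lemma TowerAt.succ {γ : Ordinal.{0}} (h : TowerAt f γ) (hγ : ω ≤ γ) (hγ₁ : γ < ω₁) :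
    TowerAt f (γ + 1) := by
  obtain ⟨P, Q, x, hx, heq⟩ := h.exists_split hγ hγ₁
  have hmaps : MapsTo (Cube.pr (le_self_add : γ ≤ γ + 1)) (tower f (γ + 1)) (tower f γ) := by
    intro z hz
    rw [heq] at hz
    rw [← hx.union]
    exact hz.imp And.right And.right
  have hsurj : SurjOn (Cube.pr (le_self_add : γ ≤ γ + 1)) (tower f (γ + 1)) (tower f γ) := by
    intro y hy
    rw [heq]
    rcases hx.union.superset hy with hy | hy
    · exact ⟨Cube.snoc y true, .inl (by simpa using hy), by simp⟩
    · exact ⟨Cube.snoc y false, .inr (by simpa using hy), by simp⟩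
  refine ⟨heq ▸ hx.perfect_succSet h.perfect.acc, fun α hα hω => ?_, fun α hα hω => ?_⟩
  · rcases hα.eq_or_lt with rfl | hα
    · exact mapsTo_id _
    · exact (h.mapsTo α (Order.lt_add_one_iff.1 hα) hω).comp hmaps
  · rcases hα.eq_or_lt with rfl | hα
    · exact surjOn_id _
    · exact (h.surjOn α (Order.lt_add_one_iff.1 hα) hω).comp hsurj

lemma exists_lt_of_finset {γ β : Ordinal.{0}} (hγ : Order.IsSuccLimit γ) (hβ : β < γ)
    (F : Finset (Iio γ)) : ∃ α < γ, β ≤ α ∧ ∀ i ∈ F, i.1 < α := by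
  refine ⟨max β (F.sup fun i => i.1 + 1), max_lt hβ ?_, le_max_left _ _, fun i hi => ?_⟩
  · exact (Finset.sup_lt_iff (bot_le.trans_lt hβ)).2 fun i _ => hγ.add_one_lt i.2
  · exact (lt_add_one _).trans_le ((Finset.le_sup (f := fun i : Iio γ => i.1 + 1) hi).trans
      (le_max_right _ _))

lemma towerAt_omega0 : TowerAt f ω := by
  refine ⟨?_, fun α h hω => ?_, fun α h hω => ?_⟩
  · rw [tower_omega0]
    refine ⟨isClosed_univ, preperfect_iff_nhds.2 fun z _ U hU => ?_⟩
    obtain ⟨F, hF⟩ := exists_finset_of_mem_nhds hU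
    obtain ⟨α, hα, -, hFα⟩ := exists_lt_of_finset Ordinal.isSuccLimit_omega0 Ordinal.omega0_pos F
    classical
    refine ⟨Function.update z ⟨α, hα⟩ (!z ⟨α, hα⟩), ⟨hF _ fun i hi => ?_, trivial⟩, fun h => ?_⟩
    · exact Function.update_of_ne (fun h => (hFα i hi).ne (congrArg Subtype.val h)) _ _
    · have := congrFun h ⟨α, hα⟩
      simp at this
  · obtain rfl := le_antisymm h hω
    exact mapsTo_id _
  · obtain rfl := le_antisymm h hω
    exact surjOn_id _

lemma TowerAt.limit {γ : Ordinal.{0}} (hlim : Order.IsSuccLimit γ) (hγ : ω < γ)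
    (ih : ∀ α < γ, ω ≤ α → TowerAt f α) : TowerAt f γ := by
  have hmaps : ∀ α (h : α ≤ γ), ω ≤ α → MapsTo (Cube.pr h) (tower f γ) (tower f α) := by
    intro α h hω
    rcases h.eq_or_lt with rfl | h'
    · exact mapsTo_id _
    · intro z hz
      rw [tower_limit f hlim] at hz
      exact hz α h' hω
  have hsurj : ∀ α (h : α ≤ γ), ω ≤ α → SurjOn (Cube.pr h) (tower f γ) (tower f α) := by
    intro α h hω
    rcases h.eq_or_lt with rfl | hα
    · exact surjOn_id _
    intro y hy
    let D : {δ // α ≤ δ ∧ δ < γ} → Set (Cube γ) := fun δ =>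
      {z | Cube.pr δ.2.2.le z ∈ tower f δ.1 ∧ Cube.pr h z = y}
    have hcl : ∀ δ, IsClosed (D δ) := fun δ =>
      (((ih δ.1 δ.2.2 (hω.trans δ.2.1)).perfect.closed.preimage (Cube.continuous_pr _))).inter
        (isClosed_singleton.preimage (Cube.continuous_pr h))
    have : Nonempty {δ // α ≤ δ ∧ δ < γ} := ⟨⟨α, le_rfl, hα⟩⟩
    obtain ⟨z, hz⟩ := IsCompact.nonempty_iInter_of_directed_nonempty_isCompact_isClosed D
      (by
        intro δ ε
        have hmax : max δ.1 ε.1 < γ := max_lt δ.2.2 ε.2.2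
        refine ⟨⟨max δ.1 ε.1, δ.2.1.trans (le_max_left _ _), hmax⟩, fun z hz => ⟨?_, hz.2⟩,
          fun z hz => ⟨?_, hz.2⟩⟩
        · exact (ih _ hmax (hω.trans (δ.2.1.trans (le_max_left _ _)))).mapsTo _ (le_max_left _ _)
            (hω.trans δ.2.1) hz.1
        · exact (ih _ hmax (hω.trans (δ.2.1.trans (le_max_left _ _)))).mapsTo _ (le_max_right _ _)
            (hω.trans ε.2.1) hz.1)
      (by
        intro δ
        obtain ⟨w, hw, hwy⟩ := (ih δ.1 δ.2.2 (hω.trans δ.2.1)).surjOn α δ.2.1 hω hy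
        refine ⟨Cube.extend γ w, ?_, ?_⟩
        · rwa [Cube.pr_extend]
        · rw [← hwy]
          exact congrArg (Cube.pr δ.2.1) (Cube.pr_extend δ.2.2.le w))
      (fun δ => (hcl δ).isCompact) hcl
    rw [mem_iInter] at hz
    refine ⟨z, ?_, (hz ⟨α, le_rfl, hα⟩).2⟩
    rw [tower_limit f hlim]
    intro β hβ hωβ
    have hmax : max α β < γ := max_lt hα hβ
    exact (ih _ hmax (hω.trans (le_max_left _ _))).mapsTo β (le_max_right _ _) hωβ
      (hz ⟨max α β, le_max_left _ _, hmax⟩).1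
  refine ⟨⟨?_, preperfect_iff_nhds.2 fun z hz U hU => ?_⟩, hmaps, hsurj⟩
  · rw [tower_limit f hlim]
    simp only [ofPred_forall]
    exact isClosed_iInter fun α => isClosed_iInter fun hα => isClosed_iInter fun hω =>
      (ih α hα hω).perfect.closed.preimage (Cube.continuous_pr _)
  · obtain ⟨F, hF⟩ := exists_finset_of_mem_nhds hU
    obtain ⟨α, hα, hω, hFα⟩ := exists_lt_of_finset hlim hγ F
    classical
    have hopen := isOpen_setOf_agree (Cube.pr hα.le z)
      (F.attach.image fun i => (⟨i.1.1, hFα i.1 i.2⟩ : Iio α))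
    obtain ⟨y, ⟨hy, hyK⟩, hne⟩ := preperfect_iff_nhds.1 (ih α hα hω).perfect.acc _
      (hmaps α hα.le hω hz) _ (hopen.mem_nhds fun i _ => rfl)
    obtain ⟨w, hw, rfl⟩ := hsurj α hα.le hω hyK
    refine ⟨w, ⟨hF w fun i hi => ?_, hw⟩, fun h => hne (h ▸ rfl)⟩
    exact hy ⟨i.1, hFα i hi⟩ (Finset.mem_image.2 ⟨⟨i, hi⟩, Finset.mem_attach _ _, rfl⟩)

theorem towerAt (f : (α : Iio (ω₁ : Ordinal.{0})) → ℕ → Cube α.1) (γ : Ordinal.{0}) (hγ : ω ≤ γ)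
    (hγ₁ : γ ≤ ω₁) : TowerAt f γ := by
  induction γ using Ordinal.limitRecOn with
  | zero => exact absurd hγ (not_le.2 Ordinal.omega0_pos)
  | add_one γ ih =>
    have hlt : γ < ω₁ := (lt_add_one γ).trans_le hγ₁
    rcases lt_or_ge γ ω with h | h
    · exact absurd hγ (not_le.2 (Ordinal.isSuccLimit_omega0.add_one_lt h))
    · exact (ih h hlt.le).succ h hlt
  | limit γ hlim ih =>
    rcases hγ.eq_or_lt with rfl | h
    · exact towerAt_omega0
    · exact TowerAt.limit hlim h fun α hα hω => ih α hα hω (hα.le.trans hγ₁)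

theorem isSimpleExtensionSystem_tower (f : (α : Iio (ω₁ : Ordinal.{0})) → ℕ → Cube α.1) :
    IsSimpleExtensionSystem (tower f) where
  base := tower_omega0 f
  perfect α h h' := (towerAt f α h h').perfect
  mapsTo α β h hω hβ := (towerAt f β (hω.trans h) hβ).mapsTo α h hω
  limit γ _ _ hlim := tower_limit f hlim
  simple γ hω hγ := by
    obtain ⟨P, Q, x, hx, heq⟩ := (towerAt f γ hω hγ.le).exists_split hω hγ
    have hxPQ : x.1 ∈ P ∩ Q := hx.inter ▸ rfl
    refine ⟨x.1, x.2, ?_, fun y hy hyx => ?_⟩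
    · have : {z ∈ tower f (γ + 1) | Cube.pr (le_self_add : γ ≤ γ + 1) z = x.1} =
          {Cube.snoc x.1 true, Cube.snoc x.1 false} := by
        ext z
        simp only [mem_ofPred_eq, mem_insert_iff, mem_singleton_iff, heq]
        constructor
        · rintro ⟨-, hz⟩
          rw [← Cube.snoc_pr_last z, hz]
          cases z.last <;> simp
        · rintro (rfl | rfl)
          · exact ⟨.inl (by simpa using hxPQ.1), by simp⟩
          · exact ⟨.inr (by simpa using hxPQ.2), by simp⟩
      rw [this]
      refine ncard_pair fun h => ?_
      have := congrArg Cube.last h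
      simp at this
    · rw [ncard_eq_one]
      rcases hx.union.superset hy with h | h
      · have hQ : y ∉ Q := fun hq => hyx (by simpa using hx.inter.subset ⟨h, hq⟩)
        refine ⟨Cube.snoc y true, ?_⟩
        ext z
        simp only [mem_ofPred_eq, mem_singleton_iff, heq]
        constructor
        · rintro ⟨⟨hz, -⟩ | ⟨-, hz⟩, rfl⟩
          · rw [← hz, Cube.snoc_pr_last]
          · exact absurd hz hQ
        · rintro rfl
          exact ⟨.inl (by simpa using h), by simp⟩
      · have hP : y ∉ P := fun hp => hyx (by simpa using hx.inter.subset ⟨hp, h⟩)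
        refine ⟨Cube.snoc y false, ?_⟩
        ext z
        simp only [mem_ofPred_eq, mem_singleton_iff, heq]
        constructor
        · rintro ⟨⟨-, hz⟩ | ⟨hz, -⟩, rfl⟩
          · exact absurd hz hP
          · rw [← hz, Cube.snoc_pr_last]
        · rintro rfl
          exact ⟨.inr (by simpa using h), by simp⟩

end Tower

/-! ### Clopen sets depending on few coordinates -/

section Coordinates

open TopologicalSpace
open scoped Ordinal

lemma Clopens.mem_finset_inf {X ι : Type*} [TopologicalSpace X] {s : Finset ι} {g : ι → Clopens X}
    {x : X} : x ∈ s.inf g ↔ ∀ i ∈ s, x ∈ g i := by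
  classical
  induction s using Finset.induction_on with
  | empty => exact iff_of_true trivial fun i hi => absurd hi (Finset.notMem_empty i)
  | insert i s hi ih =>
    rw [Finset.inf_insert, Finset.forall_mem_insert, ← ih]
    exact Iff.rfl

lemma Clopens.mem_finset_sup {X ι : Type*} [TopologicalSpace X] {s : Finset ι} {g : ι → Clopens X}
    {x : X} : x ∈ s.sup g ↔ ∃ i ∈ s, x ∈ g i := by
  rw [← SetLike.mem_coe, Clopens.coe_finset_sup]
  simp

/-- The clopen subsets of `K ⊆ 2^ι` that depend only on the coordinates in `p`. -/
def coordSubalgebra {ι : Type*} (K : Set (ι → Bool)) (p : Set ι) :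
    BooleanSubalgebra (Clopens K) where
  carrier := {C | ∀ x y : K, (∀ i ∈ p, x.1 i = y.1 i) → (x ∈ C ↔ y ∈ C)}
  supClosed' _ ha _ hb x y h := or_congr (ha x y h) (hb x y h)
  infClosed' _ ha _ hb x y h := and_congr (ha x y h) (hb x y h)
  compl_mem' ha x y h := not_congr (ha x y h)
  bot_mem' _ _ _ := Iff.rfl

lemma coordSubalgebra_mono {ι : Type*} {K : Set (ι → Bool)} {p q : Set ι} (h : p ⊆ q) :
    coordSubalgebra K p ≤ coordSubalgebra K q :=
  fun _ hC x y hxy => hC x y fun i hi => hxy i (h hi)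

/-- The clopen set of points whose `i`th coordinate is `1`. -/
def coordClopen {ι : Type*} (K : Set (ι → Bool)) (i : ι) : Clopens K :=
  clopensComap (fun x : K => x.1 i) ((continuous_apply i).comp continuous_subtype_val)
    ⟨{true}, isClopen_discrete _⟩

lemma mem_coordClopen {ι : Type*} {K : Set (ι → Bool)} {i : ι} {x : K} :
    x ∈ coordClopen K i ↔ x.1 i = true := Iff.rfl

lemma coordClopen_mem {ι : Type*} {K : Set (ι → Bool)} {i : ι} {p : Set ι} (hi : i ∈ p) :
    coordClopen K i ∈ coordSubalgebra K p := fun x y h => by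
  rw [mem_coordClopen, mem_coordClopen, h i hi]

lemma mem_closure_of_mem_coordSubalgebra {ι : Type*} {K : Set (ι → Bool)} {F : Finset ι}
    {C : Clopens K} (hC : C ∈ coordSubalgebra K (F : Set ι)) {B : BooleanSubalgebra (Clopens K)}
    (hB : ∀ i ∈ F, coordClopen K i ∈ B) : C ∈ B := by
  classical
  let cell : (F → Bool) → Clopens K := fun t =>
    F.attach.inf fun i => if t i then coordClopen K i else (coordClopen K i)ᶜ
  have hcell : ∀ t x, x ∈ cell t ↔ ∀ i : F, x.1 i = t i := by
    intro t x
    rw [Clopens.mem_finset_inf]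
    refine ⟨fun h i => ?_, fun h i _ => ?_⟩
    · have := h i (Finset.mem_attach _ _)
      cases ht : t i
      · rw [ht] at this
        have h2 : x ∉ coordClopen K i := this
        rwa [mem_coordClopen, Bool.not_eq_true] at h2
      · rw [ht] at this
        exact this
    · cases ht : t i
      · change x ∉ coordClopen K i
        rw [mem_coordClopen, h i, ht]
        simp
      · change x ∈ coordClopen K i
        rw [mem_coordClopen, h i, ht]
  have hEq : C =
      (Finset.univ.filter fun t : F → Bool => ∃ x ∈ C, ∀ i : F, x.1 i = t i).sup cell := by
    refine SetLike.ext fun x => ?_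
    rw [Clopens.mem_finset_sup]
    constructor
    · intro hx
      exact ⟨fun i => x.1 i, Finset.mem_filter.2 ⟨Finset.mem_univ _, x, hx, fun _ => rfl⟩,
        (hcell _ _).2 fun _ => rfl⟩
    · rintro ⟨t, ht, hxt⟩
      obtain ⟨y, hy, hyt⟩ := (Finset.mem_filter.1 ht).2
      refine (hC y x fun i hi => ?_).1 hy
      exact (hyt ⟨i, hi⟩).trans ((hcell t x).1 hxt ⟨i, hi⟩).symm
  rw [hEq]
  refine Finset.sup_induction B.bot_mem (fun _ ha _ hb => B.sup_mem ha hb) fun t _ =>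
    Finset.inf_induction BooleanSubalgebra.top_mem (fun _ ha _ hb => B.inf_mem ha hb) fun i _ => ?_
  split_ifs
  · exact hB i i.2
  · exact BooleanSubalgebra.compl_mem (hB i i.2)

end Coordinates

section System

open TopologicalSpace
open scoped Ordinal

variable {K : (α : Ordinal.{0}) → Set (Cube α)}

/-- The clopen subsets of `K ω₁` that depend only on the coordinates below `γ`. -/
abbrev belowSubalgebra (K : (α : Ordinal.{0}) → Set (Cube α)) (γ : Ordinal.{0}) :
    BooleanSubalgebra (Clopens (K ω₁)) :=
  coordSubalgebra (K ω₁) {i | i.1 < γ}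

lemma belowSubalgebra_mono : Monotone (belowSubalgebra K) :=
  fun _ _ h => coordSubalgebra_mono fun _ hi => lt_of_lt_of_le hi h

lemma pr_eq_pr_iff {γ δ : Ordinal.{0}} (h : γ ≤ δ) {x y : Cube δ} :
    Cube.pr h x = Cube.pr h y ↔ ∀ i : Iio δ, i.1 < γ → x i = y i :=
  ⟨fun hxy i hi => congrFun hxy ⟨i.1, hi⟩, fun hxy => funext fun i => hxy _ i.2⟩

/-- An inverse system of simple extensions whose projections are surjective. -/
structure IsSurjectiveSystem (K : (α : Ordinal.{0}) → Set (Cube α)) : Prop extends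
    IsSimpleExtensionSystem K where
  surjOn : ∀ α (h : α ≤ ω₁), ω ≤ α → SurjOn (Cube.pr h) (K ω₁) (K α)

namespace IsSurjectiveSystem

lemma isCompact (hK : IsSurjectiveSystem K) {α : Ordinal.{0}} (h : ω ≤ α) (h' : α ≤ ω₁) :
    IsCompact (K α) := (hK.perfect α h h').closed.isCompact

lemma isCompact_top (hK : IsSurjectiveSystem K) : IsCompact (K ω₁) :=
  hK.isCompact Ordinal.omega0_lt_omega_one.le le_rfl

/-- The projection onto an earlier space. -/
noncomputable def proj (hK : IsSurjectiveSystem K) {γ : Ordinal.{0}} (hω : ω ≤ γ) (hγ : γ ≤ ω₁)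
    (x : K ω₁) : K γ :=
  ⟨Cube.pr hγ x.1, hK.mapsTo γ ω₁ hγ hω le_rfl x.2⟩

lemma continuous_proj (hK : IsSurjectiveSystem K) {γ : Ordinal.{0}} (hω : ω ≤ γ) (hγ : γ ≤ ω₁) :
    Continuous (hK.proj hω hγ) :=
  ((Cube.continuous_pr hγ).comp continuous_subtype_val).subtype_mk _

lemma proj_surjective (hK : IsSurjectiveSystem K) {γ : Ordinal.{0}} (hω : ω ≤ γ) (hγ : γ ≤ ω₁) :
    Function.Surjective (hK.proj hω hγ) := by
  rintro ⟨y, hy⟩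
  obtain ⟨x, hx, rfl⟩ := hK.surjOn γ hγ hω hy
  exact ⟨⟨x, hx⟩, rfl⟩

/-- Pull back a clopen set along the projection. -/
noncomputable def lift (hK : IsSurjectiveSystem K) {γ : Ordinal.{0}} (hω : ω ≤ γ) (hγ : γ ≤ ω₁)
    (D : Clopens (K γ)) : Clopens (K ω₁) :=
  clopensComap (hK.proj hω hγ) (hK.continuous_proj hω hγ) D

lemma mem_lift (hK : IsSurjectiveSystem K) {γ : Ordinal.{0}} (hω : ω ≤ γ) (hγ : γ ≤ ω₁)
    {D : Clopens (K γ)} {x : K ω₁} : x ∈ hK.lift hω hγ D ↔ hK.proj hω hγ x ∈ D := Iff.rfl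

lemma proj_eq_iff (hK : IsSurjectiveSystem K) {γ : Ordinal.{0}} (hω : ω ≤ γ) (hγ : γ ≤ ω₁)
    {x y : K ω₁} : hK.proj hω hγ x = hK.proj hω hγ y ↔
      ∀ i ∈ {i : Iio (ω₁ : Ordinal.{0}) | i.1 < γ}, x.1 i = y.1 i :=
  Subtype.ext_iff.trans (pr_eq_pr_iff hγ)

lemma lift_mem (hK : IsSurjectiveSystem K) {γ : Ordinal.{0}} (hω : ω ≤ γ) (hγ : γ ≤ ω₁)
    (D : Clopens (K γ)) : hK.lift hω hγ D ∈ belowSubalgebra K γ := fun x y h => by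
  rw [mem_lift, mem_lift, (hK.proj_eq_iff hω hγ).2 h]

lemma exists_eq_lift (hK : IsSurjectiveSystem K) {γ : Ordinal.{0}} (hω : ω ≤ γ) (hγ : γ ≤ ω₁)
    {C : Clopens (K ω₁)} (hC : C ∈ belowSubalgebra K γ) : ∃ D, C = hK.lift hω hγ D := by
  have : CompactSpace (K ω₁) := isCompact_iff_compactSpace.1 hK.isCompact_top
  have hdep : ∀ x y, hK.proj hω hγ x = hK.proj hω hγ y → (x ∈ C ↔ y ∈ C) := fun x y h =>
    hC x y ((hK.proj_eq_iff hω hγ).1 h)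
  have hcm := (hK.continuous_proj hω hγ).isClosedMap
  have hcompl : (hK.proj hω hγ '' (C : Set (K ω₁)))ᶜ = hK.proj hω hγ '' (C : Set (K ω₁))ᶜ := by
    ext y
    obtain ⟨x, rfl⟩ := hK.proj_surjective hω hγ y
    constructor
    · intro h
      exact ⟨x, fun hx => h ⟨x, hx, rfl⟩, rfl⟩
    · rintro ⟨x', hx', h'⟩ ⟨x'', hx'', h''⟩
      exact hx' ((hdep x'' x' (h''.trans h'.symm)).1 hx'')
  refine ⟨⟨hK.proj hω hγ '' C, hcm _ C.isClosed, ?_⟩, ?_⟩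
  · rw [← isClosed_compl_iff, hcompl]
    exact hcm _ C.isOpen.isClosed_compl
  · ext x
    constructor
    · exact fun hx => ⟨x, hx, rfl⟩
    · rintro ⟨y, hy, hyx⟩
      exact (hdep y x hyx).1 hy

lemma exists_mem_belowSubalgebra (hK : IsSurjectiveSystem K) {γ : Ordinal.{0}} (hω : ω < γ)
    (hγ : γ ≤ ω₁) (hlim : Order.IsSuccLimit γ) {C : Clopens (K ω₁)}
    (hC : C ∈ belowSubalgebra K γ) : ∃ α < γ, ω ≤ α ∧ C ∈ belowSubalgebra K α := by
  obtain ⟨D, rfl⟩ := hK.exists_eq_lift hω.le hγ hC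
  obtain ⟨F, hF⟩ := exists_finset_of_clopens (hK.isCompact hω.le hγ) D
  obtain ⟨α, hα, hωα, hFα⟩ := exists_lt_of_finset hlim hω F
  refine ⟨α, hα, hωα, fun x y hxy => ?_⟩
  rw [mem_lift, mem_lift]
  exact hF _ _ fun i hi => hxy ⟨i.1, lt_of_lt_of_le i.2 hγ⟩ (hFα i hi)

lemma exists_lt_omega_one_mem (hK : IsSurjectiveSystem K) (C : Clopens (K ω₁)) :
    ∃ α < (ω₁ : Ordinal.{0}), ω ≤ α ∧ C ∈ belowSubalgebra K α :=
  hK.exists_mem_belowSubalgebra Ordinal.omega0_lt_omega_one le_rfl (Cardinal.isSuccLimit_omega 1)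
    fun x y h => by
      have : x = y := Subtype.ext (funext fun i => h i i.2)
      rw [this]

/-- The fibres of the projection from `K (γ + 1)` to `K γ`, in terms of `K ω₁`: over the split
point there are exactly two values of the coordinate `γ`, over all other points one. -/
lemma exists_split_point (hK : IsSurjectiveSystem K) {γ : Ordinal.{0}} (hω : ω ≤ γ)
    (hγ : γ < ω₁) : ∃ x : K γ,
      ∀ z w : K ω₁, hK.proj hω hγ.le z ≠ x → hK.proj hω hγ.le w = hK.proj hω hγ.le z →
        z.1 ⟨γ, hγ⟩ = w.1 ⟨γ, hγ⟩ := by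
  obtain ⟨x, hx, -, h1⟩ := hK.simple γ hω hγ
  refine ⟨⟨x, hx⟩, fun z w hz hw => ?_⟩
  have hγ' : γ + 1 ≤ ω₁ := Order.add_one_le_of_lt hγ
  obtain ⟨v, hv⟩ := ncard_eq_one.1 (h1 (hK.proj hω hγ.le z).1 (hK.proj hω hγ.le z).2
    fun h => hz (Subtype.ext h))
  have hzv : Cube.pr hγ' z.1 = v := by
    rw [← mem_singleton_iff, ← hv]
    exact ⟨hK.mapsTo _ _ hγ' (hω.trans le_self_add) le_rfl z.2, rfl⟩
  have hwv : Cube.pr hγ' w.1 = v := by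
    rw [← mem_singleton_iff, ← hv]
    exact ⟨hK.mapsTo _ _ hγ' (hω.trans le_self_add) le_rfl w.2, congrArg Subtype.val hw⟩
  exact congrFun (hzv.trans hwv.symm) ⟨γ, lt_add_one γ⟩

/-- The split point of the step from `γ` to `γ + 1`. -/
noncomputable def splitPoint (hK : IsSurjectiveSystem K) {γ : Ordinal.{0}} (hω : ω ≤ γ)
    (hγ : γ < ω₁) : K γ := (hK.exists_split_point hω hγ).choose

lemma mem_of_not_split (hK : IsSurjectiveSystem K) {γ : Ordinal.{0}} (hω : ω ≤ γ)
    (hγ : γ < ω₁) {C : Clopens (K ω₁)} (hC : C ∈ belowSubalgebra K (γ + 1))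
    (h : ∀ z w : K ω₁, hK.proj hω hγ.le z = hK.splitPoint hω hγ →
      hK.proj hω hγ.le w = hK.splitPoint hω hγ → z ∈ C → w ∈ C) : C ∈ belowSubalgebra K γ := by
  intro z w hzw
  have hp := (hK.proj_eq_iff hω hγ.le).2 hzw
  by_cases hz : hK.proj hω hγ.le z = hK.splitPoint hω hγ
  · exact ⟨h z w hz (hp ▸ hz), h w z (hp ▸ hz) hz⟩
  · refine hC z w fun i hi => ?_
    rcases (Order.lt_add_one_iff.1 (show i.1 < γ + 1 from hi)).lt_or_eq with h' | h'
    · exact hzw i h'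
    · obtain rfl : i = ⟨γ, hγ⟩ := Subtype.ext h'
      exact (hK.exists_split_point hω hγ).choose_spec z w hz hp.symm

lemma isMinimalExtension (hK : IsSurjectiveSystem K) {γ : Ordinal.{0}} (hω : ω ≤ γ)
    (hγ : γ < ω₁) : IsMinimalExtension (belowSubalgebra K γ) (belowSubalgebra K (γ + 1)) := by
  refine ⟨belowSubalgebra_mono le_self_add, ?_⟩
  rintro ⟨D, hlt, hDlt⟩
  obtain ⟨d, hd, hdn⟩ := SetLike.exists_of_lt hlt
  have hdS : d ∈ belowSubalgebra K (γ + 1) := hDlt.le hd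
  have : ∃ z w : K ω₁, hK.proj hω hγ.le z = hK.splitPoint hω hγ ∧
      hK.proj hω hγ.le w = hK.splitPoint hω hγ ∧ z ∈ d ∧ w ∉ d := by
    by_contra! hcon
    exact hdn (hK.mem_of_not_split hω hγ hdS hcon)
  obtain ⟨z, w, hz, hw, hzd, hwd⟩ := this
  -- over the split point, membership in `c` is determined by the coordinate `γ`
  have hdet : ∀ c ∈ belowSubalgebra K (γ + 1), ∀ u v : K ω₁,
      hK.proj hω hγ.le u = hK.splitPoint hω hγ → hK.proj hω hγ.le v = hK.splitPoint hω hγ →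
      u.1 ⟨γ, hγ⟩ = v.1 ⟨γ, hγ⟩ → (u ∈ c ↔ v ∈ c) := by
    intro c hc u v hu hv huv
    refine hc u v fun i hi => ?_
    rcases (Order.lt_add_one_iff.1 (show i.1 < γ + 1 from hi)).lt_or_eq with h' | h'
    · exact (hK.proj_eq_iff hω hγ.le).1 (hu.trans hv.symm) i h'
    · obtain rfl : i = ⟨γ, hγ⟩ := Subtype.ext h'
      exact huv
  have hne : z.1 ⟨γ, hγ⟩ ≠ w.1 ⟨γ, hγ⟩ := fun h => hwd ((hdet d hdS z w hz hw h).1 hzd)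
  have hcase : ∀ u : K ω₁, hK.proj hω hγ.le u = hK.splitPoint hω hγ →
      (∀ c ∈ belowSubalgebra K (γ + 1), (u ∈ c ↔ z ∈ c)) ∨
      (∀ c ∈ belowSubalgebra K (γ + 1), (u ∈ c ↔ w ∈ c)) := by
    intro u hu
    rcases eq_or_ne (u.1 ⟨γ, hγ⟩) (z.1 ⟨γ, hγ⟩) with h | h
    · exact .inl fun c hc => hdet c hc u z hu hz h
    · refine .inr fun c hc => hdet c hc u w hu hw ?_
      revert h hne
      cases u.1 ⟨γ, hγ⟩ <;> cases z.1 ⟨γ, hγ⟩ <;> cases w.1 ⟨γ, hγ⟩ <;> simp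
  have main : ∀ c ∈ belowSubalgebra K (γ + 1), (z ∈ c ∨ w ∉ c) → c ∈ D := by
    intro c hc hzw
    by_cases hsame : z ∈ c ↔ w ∈ c
    · refine hlt.le (hK.mem_of_not_split hω hγ hc fun u v hu hv huc => ?_)
      rcases hcase u hu with h1 | h1 <;> rcases hcase v hv with h2 | h2 <;>
        simp_all
    · have hzc : z ∈ c ∧ w ∉ c := by tauto
      have hsd : ∀ {B : BooleanSubalgebra (Clopens (K ω₁))} {a b : Clopens (K ω₁)}, a ∈ B → b ∈ B →
          symmDiff a b ∈ B := fun ha hb =>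
        BooleanSubalgebra.sup_mem (BooleanSubalgebra.sdiff_mem ha hb)
          (BooleanSubalgebra.sdiff_mem hb ha)
      have hmem : ∀ u : K ω₁, u ∈ symmDiff c d ↔ (u ∈ c ∧ u ∉ d) ∨ (u ∈ d ∧ u ∉ c) :=
        fun u => Iff.rfl
      have hin : symmDiff c d ∈ D := by
        refine hlt.le (hK.mem_of_not_split hω hγ (hsd hc hdS) fun u v hu hv huc => ?_)
        rw [hmem] at huc
        rcases hcase u hu with h1 | h1 <;> rw [h1 c hc, h1 d hdS] at huc <;> tauto
      have := hsd hin hd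
      rwa [symmDiff_symmDiff_cancel_right] at this
  refine hDlt.not_ge fun c hc => ?_
  by_cases h : z ∈ c ∨ w ∉ c
  · exact main c hc h
  · push Not at h
    rw [← BooleanSubalgebra.compl_mem_iff]
    exact main _ (BooleanSubalgebra.compl_mem hc) (.inl h.1)

lemma isFreeCountable (hK : IsSurjectiveSystem K) : IsFreeCountable (belowSubalgebra K ω) := by
  have hω₁ := Ordinal.omega0_lt_omega_one.le
  let idx : ℕ → Iio (ω₁ : Ordinal.{0}) := fun n => ⟨n, (Ordinal.natCast_lt_omega0 n).trans_le hω₁⟩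
  refine ⟨fun n => coordClopen (K ω₁) (idx n), fun s t hst => ?_, ?_⟩
  · let y : Cube ω := fun i => open Classical in decide (∃ n ∈ s, (n : Ordinal) = i.1)
    obtain ⟨z, hz⟩ := hK.proj_surjective le_rfl hω₁ ⟨y, hK.base ▸ mem_univ y⟩
    have hzy : ∀ n, z.1 (idx n) = y ⟨n, Ordinal.natCast_lt_omega0 n⟩ := fun n =>
      congrFun (congrArg Subtype.val hz) ⟨n, Ordinal.natCast_lt_omega0 n⟩
    have hzn : ∀ n, z.1 (idx n) = true ↔ n ∈ s := fun n => by
      rw [hzy]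
      simp [y]
    intro hbot
    have : z ∈ (⊥ : Clopens (K ω₁)) := by
      rw [← hbot]
      refine ⟨Clopens.mem_finset_inf.2 fun n hn => (hzn n).2 hn,
        Clopens.mem_finset_inf.2 fun n hn => ?_⟩
      intro h
      exact Finset.disjoint_left.1 hst ((hzn n).1 h) hn
    exact this
  · apply le_antisymm
    · rw [BooleanSubalgebra.closure_le]
      rintro _ ⟨n, rfl⟩
      exact coordClopen_mem (Ordinal.natCast_lt_omega0 n)
    · intro C hC
      obtain ⟨D, rfl⟩ := hK.exists_eq_lift le_rfl hω₁ hC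
      obtain ⟨F, hF⟩ := exists_finset_of_clopens (hK.isCompact le_rfl hω₁) D
      classical
      let F' : Finset (Iio (ω₁ : Ordinal.{0})) := F.image (Set.inclusion (Iio_subset_Iio hω₁))
      refine mem_closure_of_mem_coordSubalgebra (F := F') (fun x y hxy => ?_) fun i hi => ?_
      · rw [mem_lift, mem_lift]
        exact hF _ _ fun i hi => hxy _ (Finset.mem_coe.2 (Finset.mem_image_of_mem _ hi))
      · obtain ⟨j, -, rfl⟩ := Finset.mem_image.1 hi
        obtain ⟨n, hn⟩ := Ordinal.lt_omega0.1 j.2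
        refine BooleanSubalgebra.subset_closure ⟨n, ?_⟩
        have : idx n = Set.inclusion (Iio_subset_Iio hω₁) j := Subtype.ext hn.symm
        exact congrArg (coordClopen (K ω₁)) this

theorem isMinimallyGenerated (hK : IsSurjectiveSystem K) :
    IsMinimallyGenerated (Clopens (K ω₁)) := by
  let 𝒜 : Ordinal.{1} → BooleanSubalgebra (Clopens (K ω₁)) := fun α =>
    coordSubalgebra (K ω₁) {i | Ordinal.lift.{1, 0} i.1 < ω + α}
  have h𝒜 : ∀ α : Ordinal.{0}, 𝒜 (Ordinal.lift.{1, 0} α) = belowSubalgebra K (ω + α) := by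
    intro α
    have : (ω : Ordinal.{1}) + Ordinal.lift.{1, 0} α = Ordinal.lift.{1, 0} (ω + α) := by
      rw [Ordinal.lift_add, Ordinal.lift_omega0]
    simp only [𝒜, this, Ordinal.lift_lt]
  refine ⟨Ordinal.lift.{1, 0} ω₁, 𝒜, fun α β h _ => ?_, ?_, ?_, fun γ hγ hlim => ?_, fun α hα => ?_⟩
  · exact coordSubalgebra_mono fun i hi =>
      lt_of_lt_of_le hi (add_le_add_right h ω)
  · rw [h𝒜, eq_top_iff]
    intro C _ x y hxy
    have : x = y := Subtype.ext (funext fun i => hxy i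
      (show i.1 < ω + ω₁ from lt_of_lt_of_le i.2 le_add_self))
    rw [this]
  · have := h𝒜 0
    rw [Ordinal.lift_zero, add_zero] at this
    rw [this]
    exact hK.isFreeCountable
  · obtain ⟨γ, rfl⟩ := Ordinal.mem_range_lift_of_le hγ
    rw [Ordinal.lift_le] at hγ
    rw [Ordinal.isSuccLimit_lift] at hlim
    refine Subset.antisymm (fun C hC => ?_) (iUnion₂_subset fun α hα => ?_)
    · rw [h𝒜] at hC
      have hle : ω + γ ≤ ω₁ := (by gcongr : ω + γ ≤ ω + ω₁).trans
        ((Ordinal.isPrincipal_add_omega 1).add_eq_right Ordinal.omega0_lt_omega_one).le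
      obtain ⟨α, hα, hωα, hCα⟩ := hK.exists_mem_belowSubalgebra (lt_add_of_pos_right _ hlim.bot_lt)
        hle (Ordinal.isSuccLimit_add _ hlim) hC
      obtain ⟨β, rfl⟩ := exists_add_of_le hωα
      refine mem_iUnion₂.2 ⟨Ordinal.lift.{1, 0} β, Ordinal.lift_lt.2 (lt_of_add_lt_add_left hα), ?_⟩
      rw [h𝒜]
      exact hCα
    · exact coordSubalgebra_mono fun i hi =>
        lt_of_lt_of_le hi (add_le_add_right (le_of_lt hα) ω)
  · obtain ⟨α, rfl⟩ := Ordinal.mem_range_lift_of_le hα.le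
    rw [Ordinal.lift_lt] at hα
    have h1 : Ordinal.lift.{1, 0} α + 1 = Ordinal.lift.{1, 0} (α + 1) := by
      rw [Ordinal.lift_add, Ordinal.lift_one]
    rw [h1, h𝒜, h𝒜, ← add_assoc]
    exact hK.isMinimalExtension le_self_add
      (Ordinal.isPrincipal_add_omega 1 Ordinal.omega0_lt_omega_one hα)

end IsSurjectiveSystem

end System

/-! ### The Nikodym property -/

section Nikodym

open TopologicalSpace
open scoped Ordinal

lemma isSurjectiveSystem_tower (f : (α : Iio (ω₁ : Ordinal.{0})) → ℕ → Cube α.1) :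
    IsSurjectiveSystem (tower f) where
  toIsSimpleExtensionSystem := isSimpleExtensionSystem_tower f
  surjOn α h hω := (towerAt f ω₁ Ordinal.omega0_lt_omega_one.le le_rfl).surjOn α h hω

lemma IsBoundedMeasure.comp_clopensComap {X Y : Type*} [TopologicalSpace X] [TopologicalSpace Y]
    {μ : Clopens X → ℝ} (h : IsBoundedMeasure μ) {π : X → Y} (hπ : Continuous π) :
    IsBoundedMeasure fun D => μ (clopensComap π hπ D) := by
  refine .of_abs_le (C := variationNorm μ) (fun a b hab => ?_) fun a => h.abs_le_variationNorm _
  have hd : Disjoint (clopensComap π hπ a) (clopensComap π hπ b) := by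
    rw [← Clopens.coe_disjoint] at hab ⊢
    exact hab.preimage π
  exact h.additive _ _ hd

/-- If `a` is the preimage of `P` away from the fibre of `x`, and small near that fibre, then the
measures are unbounded on `a`. -/
lemma not_pointwise_of_isUnboundedOff {X Y : Type*} [TopologicalSpace X] [TopologicalSpace Y]
    {π : X → Y} (hπ : Continuous π) {μ : ℕ → Clopens X → ℝ} (hμ : IsAntiNikodym μ)
    {l : Clopens X → ℝ} (hl : IsBoundedMeasure l) (hl0 : ∀ a, 0 ≤ l a) {C : ℕ → ℝ}
    (hC0 : ∀ n, 0 ≤ C n) (hC : ∀ n a, |μ n a| ≤ C n * l a) {x : Y} {P Q : Set Y}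
    (hP : IsClosed P) (hQ : IsClosed Q) (hPQ : P ∪ Q = univ) (hx : P ∩ Q = {x})
    (hunb : IsUnboundedOff (fun n D => μ n (clopensComap π hπ D)) x P) {a : Clopens X}
    (ha : ∀ z, π z ≠ x → (z ∈ a ↔ π z ∈ P))
    (hsmall : ∀ ε > 0, ∃ W : Clopens Y, x ∈ W ∧ l (clopensComap π hπ W ⊓ a) < ε) : False := by
  obtain ⟨M, hM⟩ := hμ.pointwise a
  obtain ⟨n, W₀, hxW₀, hn⟩ := hunb (M + 1)
  obtain ⟨W₁, hxW₁, hW₁⟩ := hsmall (1 / (C n + 1)) (by have := hC0 n; positivity)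
  set W := W₀ ⊓ W₁ with hW
  have hxW : x ∈ W := ⟨hxW₀, hxW₁⟩
  have hopen : P \ (W : Set Y) = Qᶜ \ (W : Set Y) := by
    ext y
    simp only [Set.mem_sdiff, mem_compl_iff, and_congr_left_iff]
    intro hyW
    have hy : y ∈ P ∪ Q := hPQ ▸ mem_univ y
    refine ⟨fun h hq => hyW ?_, fun h => hy.resolve_right h⟩
    have : y ∈ ({x} : Set Y) := hx ▸ ⟨h, hq⟩
    rw [mem_singleton_iff.1 this]; exact hxW
  let D : Clopens Y := ⟨P \ W, hP.sdiff W.isOpen, hopen ▸ hQ.isOpen_compl.sdiff W.isClosed⟩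
  have hD := hn W inf_le_left hxW D rfl
  have heq : clopensComap π hπ D = a \ clopensComap π hπ W := by
    refine SetLike.ext fun z => ?_
    change (π z ∈ P ∧ π z ∉ W) ↔ (z ∈ a ∧ π z ∉ W)
    rw [and_congr_left_iff]
    intro hz
    refine (ha z ?_).symm
    intro h
    exact hz (h ▸ hxW)
  have hsum := (hμ.measure n).inf_add_sdiff a (clopensComap π hπ W)
  rw [← heq] at hsum
  have hle : l (a ⊓ clopensComap π hπ W) ≤ l (clopensComap π hπ W₁ ⊓ a) :=
    hl.mono hl0 (le_inf (inf_le_right.trans fun z hz => hz.2) inf_le_left)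
  have h1 : |μ n (a ⊓ clopensComap π hπ W)| ≤ 1 := by
    refine (hC n _).trans ?_
    have hpos : 0 < C n + 1 := by linarith [hC0 n]
    calc C n * l (a ⊓ clopensComap π hπ W) ≤ (C n + 1) * (1 / (C n + 1)) :=
          mul_le_mul (by linarith) (hle.trans hW₁.le) (hl0 _) hpos.le
      _ = 1 := by field_simp
  have h2 : |μ n (clopensComap π hπ D)| ≤ |μ n a| + |μ n (a ⊓ clopensComap π hπ W)| := by
    rw [show μ n (clopensComap π hπ D) = μ n a - μ n (a ⊓ clopensComap π hπ W) by linarith]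
    exact abs_sub _ _
  have h3 := hM n
  simp only at hD
  linarith

lemma isClub_Ici {α : Type*} [LinearOrder α] (a : α) : IsClub (Ici a) :=
  ⟨(isUpperSet_Ici a).dirSupClosed, fun b => ⟨max a b, le_max_left a b, le_max_right a b⟩⟩

/-- The tower built from a `◊`-sequence has the Nikodym property. -/
theorem hasNikodymProperty_tower {f : (α : Iio (ω₁ : Ordinal.{0})) → ℕ → Cube α.1}
    (hf : ∀ g : ℕ → Cube ω₁, IsStationary {α : Iio (ω₁ : Ordinal.{0}) |
        ω ≤ α.1 ∧ ∀ n, Cube.pr (le_of_lt α.2) (g n) = f α n}) :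
    HasNikodymProperty (Clopens (tower f ω₁)) := by
  rw [hasNikodymProperty_iff]
  rintro ⟨μ, hμ⟩
  have hK := isSurjectiveSystem_tower f
  obtain ⟨l, hl, hl0, C, hC0, hC⟩ := exists_dominating_measure hμ.measure
  obtain ⟨γ₀, hγ₀, hrefl⟩ := exists_reflecting_ordinal (belowSubalgebra (tower f))
    belowSubalgebra_mono (fun a => by
      obtain ⟨α, h, -, h'⟩ := hK.exists_lt_omega_one_mem a
      exact ⟨α, h, h'⟩) hl hl0
  -- an ordinal from which on the restrictions are unbounded
  choose N b hb using fun k : ℕ => hμ.unbounded k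
  choose ρ hρ _ hρmem using hK.exists_lt_omega_one_mem
  set γ₁ : Ordinal := ⨆ k, ρ (b k) with hγ₁
  have hγ₁lt : γ₁ < ω₁ := Ordinal.iSup_lt_omega_one fun k => hρ _
  -- the coded sequence
  let g : ℕ → Cube ω₁ := fun j α => open Classical in decide (((questionEnum j).2.2 : ℝ) <
    μ (questionEnum j).1 (clopenTrace (tower f ω₁) (Order.add_one_le_of_lt α.2)
      (clopenEnum (α.1 + 1) (questionEnum j).2.1)))
  let δ : Iio (ω₁ : Ordinal.{0}) := ⟨max γ₀ γ₁, max_lt hγ₀ hγ₁lt⟩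
  obtain ⟨⟨γ, hγ⟩, ⟨hω, hguess⟩, hδγ⟩ := hf g (isClub_Ici δ)
  have hδ : max γ₀ γ₁ ≤ γ := hδγ
  replace hω : ω ≤ γ := hω
  set π := hK.proj hω hγ.le with hπdef
  have hπ : Continuous π := hK.continuous_proj hω hγ.le
  obtain ⟨P, Q, x, hx, hsucc⟩ := (towerAt f γ hω hγ.le).exists_split hω hγ
  let ν : ℕ → Clopens (tower f γ) → ℝ := fun n D => μ n (clopensComap π hπ D)
  have hν : IsAntiNikodym ν := by
    refine ⟨fun n => (hμ.measure n).comp_clopensComap hπ, fun D => hμ.pointwise _, fun M => ?_⟩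
    obtain ⟨k, hk⟩ := exists_nat_gt M
    have hmem : b k ∈ belowSubalgebra (tower f) γ := belowSubalgebra_mono
      ((Ordinal.le_iSup _ k).trans ((le_max_right _ _).trans hδ)) (hρmem (b k))
    obtain ⟨D, hD⟩ := hK.exists_eq_lift hω hγ.le hmem
    refine ⟨N k, D, hk.trans ?_⟩
    have := hb k
    rw [hD] at this
    exact this
  have hcodes : Codes (f ⟨γ, hγ⟩) ν := by
    intro α hα j
    rw [← hguess j]
    change decide _ = true ↔ _
    rw [decide_eq_true_iff]
    exact Iff.rfl
  obtain ⟨hPu, hQu⟩ := hx.destroys ν hν hcodes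
  set a : Clopens (tower f ω₁) := coordClopen (tower f ω₁) ⟨γ, hγ⟩ with ha
  have hPcl : IsClosed (Subtype.val ⁻¹' P : Set (tower f γ)) :=
    hx.closed_left.preimage continuous_subtype_val
  have hQcl : IsClosed (Subtype.val ⁻¹' Q : Set (tower f γ)) :=
    hx.closed_right.preimage continuous_subtype_val
  have hun : (Subtype.val ⁻¹' P : Set (tower f γ)) ∪ Subtype.val ⁻¹' Q = univ := by
    rw [← preimage_union, hx.union, Subtype.coe_preimage_self]
  have hint : (Subtype.val ⁻¹' P : Set (tower f γ)) ∩ Subtype.val ⁻¹' Q = {x} := by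
    rw [← preimage_inter, hx.inter]
    ext y
    simp [Subtype.ext_iff]
  have hγ' : γ + 1 ≤ ω₁ := Order.add_one_le_of_lt hγ
  have hz : ∀ z : tower f ω₁, (z.1 ⟨γ, hγ⟩ = true ∧ (π z).1 ∈ P) ∨
      (z.1 ⟨γ, hγ⟩ = false ∧ (π z).1 ∈ Q) := fun z => by
    have : Cube.pr hγ' z.1 ∈ tower f (γ + 1) := hK.mapsTo _ _ hγ' (hω.trans le_self_add) le_rfl z.2
    rw [hsucc] at this
    exact this
  have hnot : ∀ z : tower f ω₁, π z ≠ x → (π z).1 ∈ P → (π z).1 ∉ Q := fun z hzx hp hq =>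
    hzx (Subtype.ext (by simpa using hx.inter.subset ⟨hp, hq⟩))
  have haP : ∀ z, π z ≠ x → (z ∈ a ↔ π z ∈ (Subtype.val ⁻¹' P : Set (tower f γ))) := by
    intro z hzx
    rw [mem_coordClopen]
    rcases hz z with ⟨h1, h2⟩ | ⟨h1, h2⟩
    · exact iff_of_true h1 h2
    · exact iff_of_false (by simp [h1]) fun h => hnot z hzx h h2
  have haQ : ∀ z, π z ≠ x → (z ∈ aᶜ ↔ π z ∈ (Subtype.val ⁻¹' Q : Set (tower f γ))) := by
    intro z hzx
    change z ∉ a ↔ _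
    rw [mem_coordClopen]
    rcases hz z with ⟨h1, h2⟩ | ⟨h1, h2⟩
    · exact iff_of_false (by simp [h1]) (hnot z hzx h2)
    · exact iff_of_true (by simp [h1]) h2
  obtain ⟨z, hzx⟩ := hK.proj_surjective hω hγ.le x
  have htrans : ∀ c : Clopens (tower f ω₁), (∀ ε > 0, ∃ W ∈ belowSubalgebra (tower f) γ, z ∈ W ∧
      l (W ⊓ c) < ε) → ∀ ε > 0, ∃ W : Clopens (tower f γ), x ∈ W ∧
      l (clopensComap π hπ W ⊓ c) < ε := by
    intro c hc ε hε
    obtain ⟨W, hW, hzW, hlt⟩ := hc ε hε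
    obtain ⟨D, rfl⟩ := hK.exists_eq_lift hω hγ.le hW
    exact ⟨D, hzx ▸ hzW, hlt⟩
  rcases hrefl γ ((le_max_left _ _).trans hδ) z a with h | h
  · exact not_pointwise_of_isUnboundedOff hπ hμ hl hl0 hC0 hC hPcl hQcl hun hint hPu haP
      (htrans a h)
  · refine not_pointwise_of_isUnboundedOff hπ hμ hl hl0 hC0 hC hQcl hPcl
      (by rw [union_comm, hun]) (by rw [inter_comm, hint]) hQu haQ (htrans aᶜ ?_)
    simpa only [_root_.sdiff_eq] using h

end Nikodym

/-! ### No copy of `βω` -/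

section BetaOmega

open TopologicalSpace
open scoped Ordinal

lemma card_filter_agree {T : Type*} [Fintype T] [DecidableEq T] (s : Finset T) (σ : T → Bool) :
    ((Finset.univ.filter fun β : T → Bool => ∀ t ∈ s, β t = σ t).card : ℝ) =
      (1 / 2) ^ s.card * 2 ^ Fintype.card T := by
  have h1 : (Finset.univ.filter fun β : T → Bool => ∀ t ∈ s, β t = σ t) =
      Fintype.piFinset fun t => if t ∈ s then {σ t} else Finset.univ := by
    ext β
    simp only [Finset.mem_filter, Finset.mem_univ, true_and, Fintype.mem_piFinset]
    refine forall_congr' fun t => ?_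
    by_cases ht : t ∈ s <;> simp [ht]
  have h2 : ∀ t : T, (((if t ∈ s then {σ t} else Finset.univ : Finset Bool).card : ℕ) : ℝ) =
      (if t ∈ s then 1 / 2 else 1) * 2 := by
    intro t
    by_cases ht : t ∈ s <;> simp [ht]
  rw [h1, Fintype.card_piFinset, Nat.cast_prod, Finset.prod_congr rfl fun t _ => h2 t,
    Finset.prod_mul_distrib, Finset.prod_ite_mem, Finset.univ_inter, Finset.prod_const,
    Finset.prod_const, Finset.card_univ]

/-- Truncate a binary sequence. -/
def truncate (n : ℕ) (x : ℕ → Bool) : Fin n → Bool := fun i => x i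

lemma eventually_injOn_truncate (s : Finset (ℕ → Bool)) :
    ∀ᶠ n in atTop, InjOn (truncate n) (s : Set (ℕ → Bool)) := by
  have : ∀ x ∈ s, ∀ y ∈ s, ∀ᶠ n in atTop, truncate n x = truncate n y → x = y := by
    intro x _ y _
    by_cases h : x = y
    · exact Eventually.of_forall fun _ _ => h
    · obtain ⟨k, hk⟩ := Function.ne_iff.1 h
      filter_upwards [eventually_gt_atTop k] with n hn hxy
      exact absurd (congrFun hxy ⟨k, hn⟩) hk
  have h2 := (eventually_all_finset s).2 fun x hx => (eventually_all_finset s).2 (this x hx)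
  filter_upwards [h2] with n hn x hx y hy hxy
  exact hn x hx y hy hxy

/-- If the sets `C x` restrict on a countable set to a suitable independent family, then there
is a measure for which they are stochastically independent of measure `1 / 2`. -/
lemma exists_independent_measure {X : Type*} [TopologicalSpace X]
    (p : (Σ n : ℕ, (Fin n → Bool) → Bool) → X) (C : (ℕ → Bool) → Clopens X)
    (hC : ∀ n β x, p ⟨n, β⟩ ∈ C x ↔ β (truncate n x) = true) :
    ∃ ν : Clopens X → ℝ, IsBoundedMeasure ν ∧ (∀ a, 0 ≤ ν a) ∧
      ∀ (s : Finset (ℕ → Bool)) (σ : (ℕ → Bool) → Bool),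
        ν (s.inf fun x => if σ x then C x else (C x)ᶜ) = (1 / 2) ^ s.card := by
  classical
  let m : ℕ → Clopens X → ℝ := fun n a =>
    ((Finset.univ.filter fun β : (Fin n → Bool) → Bool => p ⟨n, β⟩ ∈ a).card : ℝ) /
      2 ^ Fintype.card (Fin n → Bool)
  have hm0 : ∀ n a, 0 ≤ m n a := fun n a => by positivity
  have hm1 : ∀ n a, m n a ≤ 1 := fun n a => by
    refine (div_le_one (by positivity)).2 ?_
    have := Finset.card_filter_le (Finset.univ : Finset ((Fin n → Bool) → Bool))
      fun β => p ⟨n, β⟩ ∈ a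
    rw [Finset.card_univ, Fintype.card_fun, Fintype.card_bool] at this
    exact_mod_cast this
  have hmadd : ∀ n a b, Disjoint a b → m n (a ⊔ b) = m n a + m n b := by
    intro n a b hab
    have hdisj : ∀ z, z ∈ a → z ∉ b := fun z hz hz' =>
      Set.disjoint_left.1 (Clopens.coe_disjoint.2 hab) hz hz'
    simp only [m]
    rw [← add_div, ← Nat.cast_add, ← Finset.card_union_of_disjoint, ← Finset.filter_or]
    · exact congrArg (fun s : Finset ((Fin n → Bool) → Bool) => (s.card : ℝ) / _)
        (Finset.filter_congr fun _ _ => Iff.rfl)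
    · exact Finset.disjoint_filter.2 fun β _ h => hdisj _ h
  have hlim : ∀ a, ∃ r ∈ Icc (0 : ℝ) 1,
      Tendsto (fun n => m n a) (hyperfilter ℕ : Filter ℕ) (𝓝 r) := fun a =>
    (isCompact_Icc (a := (0 : ℝ)) (b := 1)).ultrafilter_le_nhds
      ((hyperfilter ℕ).map fun n => m n a)
      (by
        rw [Ultrafilter.coe_map, le_principal_iff]
        exact mem_map.2 (univ_mem' fun n => ⟨hm0 n a, hm1 n a⟩))
  choose ν hν01 hν using hlim
  refine ⟨ν, .of_abs_le (C := 1) (fun a b hab => ?_) (fun a => ?_), fun a => (hν01 a).1,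
    fun s σ => ?_⟩
  · refine tendsto_nhds_unique (hν (a ⊔ b)) ?_
    simp only [hmadd _ a b hab]
    exact (hν a).add (hν b)
  · rw [abs_of_nonneg (hν01 a).1]; exact (hν01 a).2
  · refine tendsto_nhds_unique (hν _) (tendsto_const_nhds.congr' ?_)
    have hle : (hyperfilter ℕ : Filter ℕ) ≤ atTop := Nat.hyperfilter_le_atTop
    filter_upwards [hle (eventually_injOn_truncate s)] with n hn
    have hset : (Finset.univ.filter fun β : (Fin n → Bool) → Bool =>
        p ⟨n, β⟩ ∈ s.inf fun x => if σ x then C x else (C x)ᶜ) =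
        Finset.univ.filter fun β : (Fin n → Bool) → Bool => ∀ t ∈ s.image (truncate n),
          β t = σ (Function.invFunOn (truncate n) (s : Set (ℕ → Bool)) t) := by
      refine Finset.filter_congr fun β _ => ?_
      rw [Clopens.mem_finset_inf, Finset.forall_mem_image]
      refine forall₂_congr fun x hx => ?_
      rw [hn.leftInvOn_invFunOn hx]
      cases σ x
      · change p ⟨n, β⟩ ∉ C x ↔ _
        rw [hC, Bool.not_eq_true]
      · exact hC n β x
    simp only [m]
    rw [hset, card_filter_agree, Finset.card_image_of_injOn hn]
    field_simp

/-- Subsets of `ω` extend from a copy of `βω` to clopen sets of the whole space. -/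
lemma exists_clopens_of_stoneCech {X : Type*} [TopologicalSpace X] [CompactSpace X] [T2Space X]
    [TotallyDisconnectedSpace X] {e : StoneCech ℕ → X} (he : Continuous e)
    (hinj : Function.Injective e) (h : ℕ → Bool) :
    ∃ C : Clopens X, ∀ n, e (stoneCechUnit n) ∈ C ↔ h n = true := by
  have hh : Continuous h := continuous_of_discreteTopology
  have hH := continuous_stoneCechExtend hh
  have hcl : ∀ b, IsClosed (e '' (stoneCechExtend hh ⁻¹' {b})) := fun b =>
    he.isClosedMap _ ((isClosed_discrete {b}).preimage hH)
  obtain ⟨V, hV, hsub, hsub'⟩ := exists_clopen_of_closed_subset_open (hcl true)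
    (hcl false).isOpen_compl (by
      rintro _ ⟨y, hy, rfl⟩ ⟨y', hy', hyy'⟩
      rw [hinj hyy'] at hy'
      have : (true : Bool) = false := hy.symm.trans hy'
      simp at this)
  refine ⟨⟨V, hV⟩, fun n => ⟨fun hn => ?_, fun hn => ?_⟩⟩
  · by_contra hf
    refine hsub' hn ⟨_, ?_, rfl⟩
    rw [mem_preimage, stoneCechExtend_stoneCechUnit]
    simpa using hf
  · refine hsub ⟨_, ?_, rfl⟩
    rw [mem_preimage, stoneCechExtend_stoneCechUnit]
    exact hn

namespace IsSurjectiveSystem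

variable {K : (α : Ordinal.{0}) → Set (Cube α)}

lemma countable_belowSubalgebra (hK : IsSurjectiveSystem K) {γ : Ordinal.{0}} (hω : ω ≤ γ)
    (hγ : γ < ω₁) : Countable (belowSubalgebra K γ) := by
  have := countable_Iio_of_lt_omega_one hγ
  have : CompactSpace (K γ) := isCompact_iff_compactSpace.1 (hK.isCompact hω hγ.le)
  have : Countable (Clopens (K γ)) := Clopens.countable_iff_secondCountable.2 inferInstance
  refine Function.Surjective.countable (f := fun D : Clopens (K γ) =>
    (⟨hK.lift hω hγ.le D, hK.lift_mem hω hγ.le D⟩ : belowSubalgebra K γ)) ?_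
  rintro ⟨C, hC⟩
  obtain ⟨D, rfl⟩ := hK.exists_eq_lift hω hγ.le hC
  exact ⟨D, rfl⟩

/-- If a positive measure has no atoms on a stage of the system, then that stage is dense in
the whole algebra. -/
lemma exists_approx (hK : IsSurjectiveSystem K) {ν : Clopens (K ω₁) → ℝ}
    (hν : IsBoundedMeasure ν) (h0 : ∀ a, 0 ≤ ν a) {γ₀ : Ordinal.{0}} (hω : ω ≤ γ₀)
    (hatom : ∀ z : K ω₁, ∀ ε > 0, ∃ W ∈ belowSubalgebra K γ₀, z ∈ W ∧ ν W < ε)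
    (γ : Ordinal.{0}) (hγ₀ : γ₀ ≤ γ) (hγ : γ ≤ ω₁) :
    ∀ a ∈ belowSubalgebra K γ, ∀ ε > 0, ∃ b ∈ belowSubalgebra K γ₀, ν (symmDiff a b) < ε := by
  induction γ using Ordinal.limitRecOn with
  | zero => exact absurd (hω.trans hγ₀) (not_le.2 Ordinal.omega0_pos)
  | add_one γ ih =>
    intro a ha ε hε
    rcases hγ₀.eq_or_lt with rfl | hlt
    · exact ⟨a, ha, by simpa [hν.map_bot] using hε⟩
    have hγγ : γ₀ ≤ γ := Order.lt_add_one_iff.1 hlt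
    have hγ' : γ < ω₁ := (lt_add_one γ).trans_le hγ
    have hωγ : ω ≤ γ := hω.trans hγγ
    obtain ⟨z, hz⟩ := hK.proj_surjective hωγ hγ'.le (hK.splitPoint hωγ hγ')
    obtain ⟨W, hW, hzW, hνW⟩ := hatom z (ε / 2) (half_pos hε)
    have hWγ : W ∈ belowSubalgebra K γ := belowSubalgebra_mono hγγ hW
    have haW : a \ W ∈ belowSubalgebra K γ := by
      refine hK.mem_of_not_split hωγ hγ' (BooleanSubalgebra.sdiff_mem ha
        (belowSubalgebra_mono le_self_add hWγ)) fun u v hu _ huaW => absurd ?_ huaW.2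
      exact (hWγ z u ((hK.proj_eq_iff hωγ hγ'.le).1 (hz.trans hu.symm))).1 hzW
    obtain ⟨b, hb, hlt'⟩ := ih hγγ hγ'.le (a \ W) haW (ε / 2) (half_pos hε)
    refine ⟨b, hb, ?_⟩
    have hle : symmDiff a b ≤ symmDiff (a \ W) b ⊔ W := by
      intro u hu
      by_cases huW : u ∈ W
      · exact .inr huW
      · rcases hu with ⟨h1, h2⟩ | ⟨h1, h2⟩
        · exact .inl (.inl ⟨⟨h1, huW⟩, h2⟩)
        · exact .inl (.inr ⟨h1, fun h => h2 h.1⟩)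
    have hsub : ν (symmDiff (a \ W) b ⊔ W) ≤ ν (symmDiff (a \ W) b) + ν W := by
      rw [← sdiff_sup_self, hν.additive _ _ disjoint_sdiff_self_left]
      gcongr
      exact hν.mono h0 sdiff_le
    linarith [hν.mono h0 hle]
  | limit γ hlim ih =>
    intro a ha ε hε
    rcases hγ₀.eq_or_lt with rfl | hlt
    · exact ⟨a, ha, by simpa [hν.map_bot] using hε⟩
    obtain ⟨α, hα, -, haα⟩ := hK.exists_mem_belowSubalgebra (hω.trans_lt hlt) hγ hlim ha
    have hmax : max γ₀ α < γ := max_lt hlt hα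
    exact ih _ hmax (le_max_left _ _) (hmax.le.trans hγ) a
      (belowSubalgebra_mono (le_max_right _ _) haα) ε hε

theorem not_exists_betaOmega (hK : IsSurjectiveSystem K) {e : StoneCech ℕ → K ω₁}
    (he : Continuous e) (hinj : Function.Injective e) : False := by
  have : CompactSpace (K ω₁) := isCompact_iff_compactSpace.1 hK.isCompact_top
  obtain ⟨ι, hι⟩ := exists_injective_nat (Σ n : ℕ, (Fin n → Bool) → Bool)
  let p : (Σ n : ℕ, (Fin n → Bool) → Bool) → K ω₁ := fun d => e (stoneCechUnit (ι d))
  have hex : ∀ x : ℕ → Bool, ∃ C : Clopens (K ω₁), ∀ n β,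
      p ⟨n, β⟩ ∈ C ↔ β (truncate n x) = true := by
    intro x
    classical
    obtain ⟨C, hC⟩ := exists_clopens_of_stoneCech he hinj
      fun k => decide (∃ d, ι d = k ∧ d.2 (truncate d.1 x) = true)
    refine ⟨C, fun n β => (hC _).trans ?_⟩
    rw [decide_eq_true_iff]
    constructor
    · rintro ⟨d, hd, h⟩
      obtain rfl := hι hd
      exact h
    · exact fun h => ⟨_, rfl, h⟩
  choose C hC using hex
  obtain ⟨ν, hν, h0, hind⟩ := exists_independent_measure p C fun n β x => hC x n β
  choose ρ hρ hωρ hρmem using hK.exists_lt_omega_one_mem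
  let x : ℕ ↪ (ℕ → Bool) := Infinite.natEmbedding _
  let γ₀ : Ordinal := ⨆ k, ρ (C (x k))
  have hle : ∀ k, ρ (C (x k)) ≤ γ₀ := fun k => Ordinal.le_iSup (fun k => ρ (C (x k))) k
  have hγ₀ : γ₀ < ω₁ := Ordinal.iSup_lt_omega_one fun k => hρ _
  have hω : ω ≤ γ₀ := (hωρ _).trans (hle 0)
  have hatom : ∀ z : K ω₁, ∀ ε > 0, ∃ W ∈ belowSubalgebra K γ₀, z ∈ W ∧ ν W < ε := by
    intro z ε hε
    obtain ⟨k, hk⟩ := exists_pow_lt_of_lt_one hε (by norm_num : (1 / 2 : ℝ) < 1)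
    classical
    refine ⟨_, ?_, ?_, lt_of_eq_of_lt (hind ((Finset.range k).map x) fun y => decide (z ∈ C y)) ?_⟩
    · refine Finset.inf_induction BooleanSubalgebra.top_mem
        (fun _ ha _ hb => BooleanSubalgebra.inf_mem ha hb) fun y hy => ?_
      obtain ⟨j, -, rfl⟩ := Finset.mem_map.1 hy
      have hmem : C (x j) ∈ belowSubalgebra K γ₀ := belowSubalgebra_mono (hle j) (hρmem _)
      split_ifs
      · exact hmem
      · exact BooleanSubalgebra.compl_mem hmem
    · refine Clopens.mem_finset_inf.2 fun y _ => ?_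
      by_cases hy : z ∈ C y
      · simp [hy]
      · simp only [hy, decide_false, Bool.false_eq_true, if_false]
        exact hy
    · simpa using hk
  have happ : ∀ y, ∃ b ∈ belowSubalgebra K γ₀, ν (symmDiff (C y) b) < 1 / 8 := fun y =>
    hK.exists_approx hν h0 hω hatom ω₁ hγ₀.le le_rfl (C y)
      (belowSubalgebra_mono (hρ _).le (hρmem _)) _ (by norm_num)
  choose b hb hbν using happ
  have hcount := hK.countable_belowSubalgebra hω hγ₀
  obtain ⟨j, hj⟩ := exists_injective_nat (belowSubalgebra K γ₀)
  have hnot : ¬ Function.Injective b := by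
    intro hbinj
    classical
    refine Function.cantor_injective (fun S : Set ℕ =>
      j ⟨b fun n => decide (n ∈ S), hb _⟩) fun S T hST => ?_
    have := hbinj (congrArg Subtype.val (hj hST))
    ext n
    have hn := congrFun this n
    simpa using hn
  simp only [Function.Injective, not_forall] at hnot
  obtain ⟨y, z, hyz, hne⟩ := hnot
  classical
  have h4 := hind {y, z} fun w => decide (w = y)
  rw [Finset.card_pair hne, Finset.inf_insert, Finset.inf_singleton] at h4
  simp only [decide_true, if_true, decide_eq_true_eq, Ne.symm hne, if_false] at h4
  have hle2 : C y ⊓ (C z)ᶜ ≤ symmDiff (C y) (b y) ⊔ symmDiff (C z) (b z) := by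
    rintro u ⟨hu1, hu2⟩
    by_cases hub : u ∈ b y
    · exact .inr (.inr ⟨hyz ▸ hub, hu2⟩)
    · exact .inl (.inl ⟨hu1, hub⟩)
  have hsub : ν (symmDiff (C y) (b y) ⊔ symmDiff (C z) (b z)) ≤
      ν (symmDiff (C y) (b y)) + ν (symmDiff (C z) (b z)) := by
    rw [← sdiff_sup_self, hν.additive _ _ disjoint_sdiff_self_left]
    gcongr
    exact hν.mono h0 sdiff_le
  have := hν.mono h0 hle2
  have h5 := hbν y
  have h6 := hbν z
  norm_num at h4
  linarith

end IsSurjectiveSystem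

end BetaOmega

/-! ### The Stone space -/

section Stone

open TopologicalSpace
open scoped Ordinal

universe u

lemma isOpen_stone {A : Type u} [BooleanAlgebra A] (a : A) :
    IsOpen {F : StoneSpace A | a ∈ F.1} :=
  TopologicalSpace.isOpen_generateFrom_of_mem ⟨a, rfl⟩

lemma StoneSpace.not_mem_and_compl {A : Type u} [BooleanAlgebra A] (F : StoneSpace A) {a : A}
    (h : a ∈ F.1) (h' : aᶜ ∈ F.1) : False :=
  F.2.1 (by simpa using Order.PFilter.inf_mem h h')

instance {A : Type u} [BooleanAlgebra A] : T2Space (StoneSpace A) := by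
  refine ⟨fun F G hFG => ?_⟩
  have key : ∀ F G : StoneSpace A, ∀ a ∈ F.1, a ∉ G.1 →
      ∃ u v : Set (StoneSpace A), IsOpen u ∧ IsOpen v ∧ F ∈ u ∧ G ∈ v ∧ Disjoint u v :=
    fun F G a ha ha' => ⟨_, _, isOpen_stone a, isOpen_stone aᶜ, ha, (G.2.2 a).resolve_left ha',
      Set.disjoint_left.2 fun H h h' => H.not_mem_and_compl h h'⟩
  by_cases h : ∃ a ∈ F.1, a ∉ G.1
  · obtain ⟨a, ha, ha'⟩ := h
    exact key F G a ha ha'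
  · push Not at h
    obtain ⟨a, ha, ha'⟩ : ∃ a ∈ G.1, a ∉ F.1 := by
      by_contra! h'
      exact hFG (Subtype.ext (SetLike.coe_injective (Subset.antisymm h h')))
    obtain ⟨u, v, hu, hv, h1, h2, h3⟩ := key G F a ha ha'
    exact ⟨v, u, hv, hu, h2, h1, h3.symm⟩

variable {X : Type u} [TopologicalSpace X]

lemma isPFilter_clopens (x : X) : Order.IsPFilter {a : Clopens X | x ∈ a} :=
  .of_def ⟨⊤, trivial⟩ (fun a ha b hb => ⟨a ⊓ b, ⟨ha, hb⟩, inf_le_left, inf_le_right⟩)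
    fun hab ha => hab ha

/-- The ultrafilter of clopen sets containing a point. -/
def pointFilter (x : X) : StoneSpace (Clopens X) :=
  ⟨(isPFilter_clopens x).toPFilter, fun h => h, fun a => em (x ∈ a)⟩

lemma mem_pointFilter {x : X} {a : Clopens X} : a ∈ (pointFilter x).1 ↔ x ∈ a := Iff.rfl

lemma continuous_pointFilter : Continuous (pointFilter : X → StoneSpace (Clopens X)) := by
  refine continuous_generateFrom_iff.2 ?_
  rintro _ ⟨a, rfl⟩
  exact a.isOpen

lemma pointFilter_bijective [CompactSpace X] [T2Space X] [TotallyDisconnectedSpace X] :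
    Function.Bijective (pointFilter : X → StoneSpace (Clopens X)) := by
  constructor
  · intro x y hxy
    by_contra hne
    obtain ⟨W, hxW, hW⟩ := exists_clopens_of_mem_nhds (isOpen_compl_singleton.mem_nhds hne)
    have : W ∈ (pointFilter y).1 := hxy ▸ mem_pointFilter.2 hxW
    exact hW this rfl
  · intro F
    have : Nonempty {a : Clopens X // a ∈ F.1} := ⟨⟨⊤, Order.PFilter.top_mem⟩⟩
    obtain ⟨x, hx⟩ := IsCompact.nonempty_iInter_of_directed_nonempty_isCompact_isClosed
      (fun a : {a : Clopens X // a ∈ F.1} => (a.1 : Set X))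
      (fun a b => ⟨⟨a.1 ⊓ b.1, Order.PFilter.inf_mem a.2 b.2⟩, inter_subset_left,
        inter_subset_right⟩)
      (fun a => by
        rw [nonempty_iff_ne_empty]
        intro h
        refine F.2.1 ?_
        have : a.1 = ⊥ := SetLike.coe_injective h
        exact Order.PFilter.mem_of_le this.le a.2)
      (fun a => a.1.isClosed.isCompact) (fun a => a.1.isClosed)
    rw [mem_iInter] at hx
    refine ⟨x, Subtype.ext (SetLike.ext fun a => ⟨fun ha => ?_, fun ha => ?_⟩)⟩
    · by_contra h
      exact hx ⟨aᶜ, (F.2.2 a).resolve_left h⟩ ha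
    · exact hx ⟨a, ha⟩

/-- A zero-dimensional compact space is the Stone space of its clopen algebra. -/
noncomputable def stoneHomeomorph [CompactSpace X] [T2Space X] [TotallyDisconnectedSpace X] :
    X ≃ₜ StoneSpace (Clopens X) :=
  Continuous.homeoOfEquivCompactToT2 (f := Equiv.ofBijective _ pointFilter_bijective)
    continuous_pointFilter

theorem IsSurjectiveSystem.isEfimovSpace {K : (α : Ordinal.{0}) → Set (Cube α)}
    (hK : IsSurjectiveSystem K) (hN : HasNikodymProperty (Clopens (K ω₁))) :
    IsEfimovSpace (StoneSpace (Clopens (K ω₁))) := by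
  have : CompactSpace (K ω₁) := isCompact_iff_compactSpace.1 hK.isCompact_top
  have hinf : Infinite (Cube ω) := by
    refine Infinite.of_injective (fun n : ℕ => fun i : Iio (ω : Ordinal.{0}) =>
      open Classical in decide (i.1 = n)) fun m n hmn => ?_
    have := congrFun hmn ⟨m, Ordinal.natCast_lt_omega0 m⟩
    simpa using this
  let φ : K ω₁ ≃ₜ StoneSpace (Clopens (K ω₁)) := stoneHomeomorph
  refine ⟨φ.compactSpace, inferInstance, ?_, ?_, ?_⟩
  · have : Infinite (K ω₁) := by
      refine Infinite.of_surjective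
        (fun x : K ω₁ => Cube.pr Ordinal.omega0_lt_omega_one.le x.1) fun y => ?_
      obtain ⟨x, hx, rfl⟩ := hK.surjOn ω Ordinal.omega0_lt_omega_one.le le_rfl
        (hK.base ▸ mem_univ y)
      exact ⟨⟨x, hx⟩, rfl⟩
    exact φ.toEquiv.infinite_iff.1 this
  · rintro ⟨x, l, hx, -, hne⟩
    refine hasNikodymProperty_iff.1 hN (exists_isAntiNikodym_of_tendsto
      (x := fun n => φ.symm (x n)) (l := φ.symm l) ((φ.symm.continuous.tendsto l).comp hx) ?_)
    exact fun n h => hne n (φ.symm.injective h)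
  · rintro ⟨e, he⟩
    exact hK.not_exists_betaOmega (e := φ.symm ∘ e) (φ.symm.continuous.comp he.continuous)
      (φ.symm.injective.comp he.injective)

end Stone

open scoped Ordinal in
theorem theorem3p1 (hDiamond : DiamondPrinciple) :
    ∃ K : (α : Ordinal.{0}) → Set (Cube α),
      IsSimpleExtensionSystem K ∧
      IsMinimallyGenerated (TopologicalSpace.Clopens (K ω₁)) ∧
      HasNikodymProperty (TopologicalSpace.Clopens (K ω₁)) ∧
      IsEfimovSpace (StoneSpace (TopologicalSpace.Clopens (K ω₁))) := by
  obtain ⟨f, hf⟩ := hDiamond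
  have hK := isSurjectiveSystem_tower f
  exact ⟨tower f, isSimpleExtensionSystem_tower f, hK.isMinimallyGenerated,
    hasNikodymProperty_tower hf, hK.isEfimovSpace (hasNikodymProperty_tower hf)⟩
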